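/- Consider the nearest-neighbour Ising model on $\mathbb Z^2$ with zero external field, with weights $\exp(\beta\sum_{\{x,y\}}S_xS_y)$, at its critical inverse temperature $\beta_c$ (the infimum of the $\beta\ge 0$ at which there is more than one infinite-volume Gibbs distribution). Let $P_c$, with expectation $E_c$, be the infinite-volume joint distribution at $\beta_c$ of the spins $S_x$ and of the FK bond variables, that is, the limit as $V\uparrow\mathbb Z^2$ of the finite-volume distributions in $V$ with free boundary condition in which the spins have the Gibbs distribution and, given the spins, each bond of $V$ is independently open with probability $1-e^{-2\beta_c}$ if its end spins agree and closed if they disagree. Let $\tau_c(x)=E_c(S_0S_x)$, let $C_i$ be the FK clusters (the connected components of $\mathbb Z^2$ under open bonds), and for $a>0$ let $\hat C_i^a=aC_i\cap[0,1]^2$, let $|\hat C_i^a|$ be its number of sites and $\mathrm{diam}(\hat C_i^a)$ its Euclidean diameter. Put $\Theta_a^{-2}=\sum_{x,y\in[0,1/a]^2\cap\mathbb Z^2}\tau_c(y-x)$. Assume that for some fixed $\theta<1$ there are constants $K_1>0$ and $K_2<\infty$ such that for every sufficiently small $\varepsilon>0$ there is an $R$ such that $$K_2\,\tau_c(x_\varepsilon)\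 \ge\ \tau_c(x)\ \ge\ K_1\,\varepsilon^{2\theta}\,\tau_c(x_\varepsilon)$$ for every $x\in\mathbb Z^2$ with $\|x\|\ge R$ and every $x_\varepsilon\in\mathbb Z^2$ with $\|x_\varepsilon-\varepsilon x\|\le 1/\sqrt2$, where $\|\cdot\|$ is the Euclidean norm. Then $$\lim_{\varepsilon\to0}\ \limsup_{a\to0}\ \Theta_a^2\,E_c\Big(\sum_{i:\,\mathrm{diam}(\hat C_i^a)\le\varepsilon}|\hat C_i^a|^2\Big)=0 ,$$ and, more precisely, there is a constant $K$ such that for every $\varepsilon>0$ the above $\limsup_{a\to0}$ is at most $K\,\varepsilon^{2(1-\theta)}$. -/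

import Mathlib

open Filter Topology MeasureTheory
open scoped ENNReal

noncomputable section

namespace IsingFK

/-! ### The square lattice -/

/-- Sites of the square lattice. -/
abbrev Site : Type := ℤ × ℤ

/-- Nearest-neighbour bonds of the square lattice. The bond `(x, 0)` joins `x` and `x + (1, 0)`,
the bond `(x, 1)` joins `x` and `x + (0, 1)`; every unordered pair of nearest neighbours occurs
exactly once. -/
abbrev Bond : Type := Site × Fin 2

/-- First endpoint of a bond. -/
def Bond.src (b : Bond) : Site := b.1

/-- Second endpoint of a bond. -/
def Bond.tgt (b : Bond) : Site := b.1 + (if b.2 = 0 then (1, 0) else (0, 1))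

/-- The Euclidean plane. -/
abbrev Plane : Type := EuclideanSpace ℝ (Fin 2)

/-- The inclusion of the lattice in the Euclidean plane. -/
def toPlane (x : Site) : Plane := !₂[(x.1 : ℝ), (x.2 : ℝ)]

/-- The bonds with both endpoints in `V`. -/
def bondsIn (V : Finset Site) : Finset Bond :=
  (V ×ˢ Finset.univ).filter fun b => Bond.src b ∈ V ∧ Bond.tgt b ∈ V

/-- The bonds with at least one endpoint in `V`. -/
def bondsTouching (V : Finset Site) : Finset Bond :=
  ((V ∪ V.image (fun x => x - (1, 0)) ∪ V.image (fun x => x - (0, 1))) ×ˢ Finset.univ).filter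
    fun b => Bond.src b ∈ V ∨ Bond.tgt b ∈ V

theorem mem_bondsIn {V : Finset Site} {b : Bond} :
    b ∈ bondsIn V ↔ Bond.src b ∈ V ∧ Bond.tgt b ∈ V := by
  simp only [bondsIn, Finset.mem_filter, Finset.mem_product, Finset.mem_univ, and_true]
  exact ⟨fun h => h.2, fun h => ⟨h.1, h⟩⟩

theorem mem_bondsTouching {V : Finset Site} {b : Bond} :
    b ∈ bondsTouching V ↔ Bond.src b ∈ V ∨ Bond.tgt b ∈ V := by
  simp only [bondsTouching, Finset.mem_filter, Finset.mem_product, Finset.mem_univ, and_true,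
    Finset.mem_union, Finset.mem_image]
  refine ⟨fun h => h.2, fun h => ⟨?_, h⟩⟩
  rcases h with h | h
  · exact Or.inl (Or.inl h)
  · unfold Bond.tgt at h
    split_ifs at h with h0
    · exact Or.inl (Or.inr ⟨_, h, by simp⟩)
    · exact Or.inr ⟨_, h, by simp⟩

/-! ### The Ising model at zero external field -/

/-- Spin configurations: `true` is the spin `+1`, `false` is the spin `-1`. -/
abbrev SpinConfig : Type := Site → Bool

/-- The spin `S_x ∈ {+1, -1}` as a real number. -/
def spin (σ : SpinConfig) (x : Site) : ℝ := if σ x then 1 else -1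

/-- The configuration equal to `s` on the finite set `V` and to `η` off `V`. -/
def glue {α : Type} [DecidableEq α] (V : Finset α) (s : V → Bool) (η : α → Bool) : α → Bool :=
  fun x => if h : x ∈ V then s ⟨x, h⟩ else η x

/-- The energy `- ∑ S_x S_y` of a finite set of bonds. -/
def energy (B : Finset Bond) (σ : SpinConfig) : ℝ :=
  -∑ b ∈ B, spin σ (Bond.src b) * spin σ (Bond.tgt b)

/-- The finite-volume Ising Gibbs distribution in `V` at inverse temperature `β` (zero external
field) with boundary condition `η` outside `V`. -/
def gibbsKernel (β : ℝ) (V : Finset Site) (η : SpinConfig) : Measure SpinConfig :=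
  (∑ s : V → Bool, ENNReal.ofReal (Real.exp (-β * energy (bondsTouching V) (glue V s η))))⁻¹ •
    ∑ s : V → Bool, ENNReal.ofReal (Real.exp (-β * energy (bondsTouching V) (glue V s η))) •
      Measure.dirac (glue V s η)

/-- Infinite-volume Gibbs distributions at inverse temperature `β` and zero external field:
probability measures satisfying the Dobrushin-Lanford-Ruelle equations. -/
def IsGibbs (β : ℝ) (μ : Measure SpinConfig) : Prop :=
  IsProbabilityMeasure μ ∧
    ∀ (V : Finset Site) (A : Set SpinConfig), MeasurableSet A →
      ∫⁻ η, gibbsKernel β V η A ∂μ = μ A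

/-- `βc` is the critical inverse temperature: the infimum of the inverse temperatures at which
there is more than one infinite-volume Gibbs distribution. -/
def IsCriticalInverseTemperature (βc : ℝ) : Prop :=
  IsGLB {β : ℝ | 0 ≤ β ∧ ∃ μ ν : Measure SpinConfig, IsGibbs β μ ∧ IsGibbs β ν ∧ μ ≠ ν} βc

/-! ### Spins together with their FK bonds -/

/-- Bond configurations: `true` is occupied (open), `false` is vacant. -/
abbrev BondConfig : Type := Bond → Bool

/-- Conditional probability, given the spins, of the occupation variable of a bond: a bond whose
end spins agree is open with probability `1 - exp (-2β)`, a bond whose end spins disagree is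
closed. -/
def bondProb (β : ℝ) (agree isOpen : Bool) : ℝ :=
  if agree then (if isOpen then 1 - Real.exp (-2 * β) else Real.exp (-2 * β))
  else (if isOpen then 0 else 1)

/-- The unnormalized joint weight of spins and FK bonds in the finite volume `V` with free
boundary condition: the Gibbs weight of the spins times the conditional probability of the bonds,
which are independent given the spins. Equivalently, the bonds have the random-cluster
distribution with `q = 2` and, given the bonds, the clusters get independent symmetric signs. -/
def jointWeight (β : ℝ) (V : Finset Site) (σ : SpinConfig) (n : BondConfig) : ℝ :=
  Real.exp (-β * energy (bondsIn V) σ) *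
    ∏ b ∈ bondsIn V, bondProb β (decide (σ (Bond.src b) = σ (Bond.tgt b))) (n b)

/-- The joint distribution of spins and FK bonds in the finite volume `V` with free boundary
condition, as a measure on all configurations: spins off `V` are `+1`, bonds off `V` are closed
(and do not interact with `V`). -/
def finiteSystem (β : ℝ) (V : Finset Site) : Measure (SpinConfig × BondConfig) :=
  (∑ s : V → Bool, ∑ n : bondsIn V → Bool, ENNReal.ofReal (jointWeight β V
      (glue V s fun _ => true) (glue (bondsIn V) n fun _ => false)))⁻¹ •
    ∑ s : V → Bool, ∑ n : bondsIn V → Bool, ENNReal.ofReal (jointWeight β V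
      (glue V s fun _ => true) (glue (bondsIn V) n fun _ => false)) •
        Measure.dirac (glue V s (fun _ => true), glue (bondsIn V) n fun _ => false)

/-- `P` is the infinite-volume joint distribution of spins and FK bonds at inverse temperature
`β`: a probability measure whose finite-dimensional distributions are the limits of those of the
finite-volume systems as `V` increases to the whole lattice. -/
def IsInfiniteSystem (β : ℝ) (P : Measure (SpinConfig × BondConfig)) : Prop :=
  IsProbabilityMeasure P ∧
    ∀ (A : Finset Site) (B : Finset Bond) (σ : SpinConfig) (n : BondConfig),
      Tendsto
        (fun V : Finset Site => finiteSystem β V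
          {c | (∀ x ∈ A, c.1 x = σ x) ∧ ∀ b ∈ B, c.2 b = n b})
        atTop
        (𝓝 (P {c | (∀ x ∈ A, c.1 x = σ x) ∧ ∀ b ∈ B, c.2 b = n b}))

/-- The two-point function `τ(x) = ⟨S_0 S_x⟩`. -/
def twoPoint (P : Measure (SpinConfig × BondConfig)) (x : Site) : ℝ :=
  ∫ c, spin c.1 0 * spin c.1 x ∂P

/-! ### FK clusters and their rescaled areas -/

/-- The graph of open bonds; its connected components are the FK clusters. -/
def openGraph (n : BondConfig) : SimpleGraph Site :=
  SimpleGraph.fromRel fun x y => ∃ b : Bond, n b = true ∧ Bond.src b = x ∧ Bond.tgt b = y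

/-- The restriction of `a C` to the unit square `[0, 1]²`. -/
def restrictedCluster (a : ℝ) (C : Set Site) : Set Plane :=
  ((fun x : Site => a • toPlane x) '' C) ∩ {z | ∀ i, z i ∈ Set.Icc (0 : ℝ) 1}

/-- The sum of the squared numbers of sites of the restricted FK clusters of Euclidean diameter at
most `ε`. -/
def smallClusterSum (a ε : ℝ) (n : BondConfig) : ℝ≥0∞ :=
  ∑' C : (openGraph n).ConnectedComponent,
    if Metric.diam (restrictedCluster a C.supp) ≤ ε then
      ((restrictedCluster a C.supp).ncard : ℝ≥0∞) ^ 2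
    else 0

/-- The lattice box `[0, L]² ∩ ℤ²`. -/
def box (L : ℝ) : Finset Site := Finset.Icc 0 ⌊L⌋ ×ˢ Finset.Icc 0 ⌊L⌋

/-- The scale factor `Θ_a`, given by `Θ_a⁻¹ = (∑_{x, y ∈ [0, 1/a]² ∩ ℤ²} τ(y - x))^{1/2}`. -/
def scaleFactor (τ : Site → ℝ) (a : ℝ) : ℝ :=
  (Real.sqrt (∑ x ∈ box (1 / a), ∑ y ∈ box (1 / a), τ (y - x)))⁻¹

/-- The two-sided comparison hypothesis on a two-point function `τ` with exponent `θ`: for every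
small `ε > 0`, and then for every `x` of large norm (how large may depend on `ε`),
`K₂ τ(x_ε) ≥ τ(x) ≥ K₁ ε^{2θ} τ(x_ε)` for every lattice point `x_ε` within distance `1/√2` of
`ε x`. -/
def PowerLawComparison (τ : Site → ℝ) (θ : ℝ) : Prop :=
  ∃ K₁ > (0 : ℝ), ∃ K₂ : ℝ, ∀ᶠ ε : ℝ in 𝓝[>] 0, ∃ R : ℝ, ∀ x : Site, R ≤ ‖toPlane x‖ →
    ∀ x' : Site, ‖toPlane x' - ε • toPlane x‖ ≤ 1 / Real.sqrt 2 →
      τ x ≤ K₂ * τ x' ∧ K₁ * ε ^ (2 * θ) * τ x' ≤ τ x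

/-- The rescaled expectation `Θ_a² E(∑_{i : diam ≤ ε} |Ĉ_i|²)`. -/
def rescaledSmallArea (P : Measure (SpinConfig × BondConfig)) (a ε : ℝ) : ℝ≥0∞ :=
  ENNReal.ofReal (scaleFactor (twoPoint P) a ^ 2) * ∫⁻ c, smallClusterSum a ε c.2 ∂P

end IsingFK

end

noncomputable section

namespace IsingFK

/-! Two sites of one cluster of diameter at most `ε` are within `ε / a` in lattice units, so the sum
of squares is at most the number of connected pairs at that distance. In the FK representation the
connection probability is bounded by `τ (y - x)`. Write `S m` for the sum of `τ` over the centred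
square of half-side `m`. The expectation is then at most the number of sites of the box times `S (ε
/ a)`, while the normalising double sum is at least a quarter of that number times `S m`, for any
`m` up to half the side of the box. It remains to bound `S (ε / a) / S m` for `m` of order `1 / a`.

Cut a large square into blocks of odd side `p = 2q + 1`. Every site of the block around `p y` is
sent by the scaling `1 / p` to within `1 / √2` of `y`, so the lower comparison makes the block sum
at least `K₁ p ^ (2 - 2θ) τ y`. Hence enlarging a square by `p` multiplies `S` by at least a
constant times `p ^ (2 (1 - θ))`, and `p` of order `1 / ε` gives the claim
(`exists_eventually_squareSum_le`, `exists_limsup_le`).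

The comparison concerns distant sites only, so `S` must diverge for the remaining part to be
negligible. This needs `τ > 0` along an axis, hence `βc > 0`: at `β = 0` clusters are single sites
and the conclusion fails. Positivity of `βc` follows from uniqueness of the Gibbs distribution at
high temperature, and positivity of `τ` from opening bonds one at a time at bounded cost. -/

/-- The centred lattice square of side `2m + 1`. -/
def square (m : ℕ) : Finset Site := Finset.Icc (-(m : ℤ)) m ×ˢ Finset.Icc (-(m : ℤ)) m

/-- The sum of `τ` over the centred lattice square. -/
def squareSum (τ : Site → ℝ) (m : ℕ) : ℝ := ∑ z ∈ square m, τ z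

/-! ### Centred squares and their decomposition into blocks -/

theorem mem_square {m : ℕ} {z : Site} :
    z ∈ square m ↔ (-(m : ℤ) ≤ z.1 ∧ z.1 ≤ m) ∧ (-(m : ℤ) ≤ z.2 ∧ z.2 ≤ m) := by
  simp [square]

theorem square_mono {m k : ℕ} (h : m ≤ k) : square m ⊆ square k := by
  intro z hz
  rw [mem_square] at *
  omega

theorem squareSum_mono {τ : Site → ℝ} (hτ : ∀ z, 0 ≤ τ z) : Monotone (squareSum τ) :=
  fun _ _ h => Finset.sum_le_sum_of_subset_of_nonneg (square_mono h) fun z _ _ => hτ z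

theorem card_square (m : ℕ) : (square m).card = (2 * m + 1) ^ 2 := by
  simp only [square, Finset.card_product, Int.card_Icc, sq]
  congr 1 <;> omega

/-- Division by `2q + 1` with remainder in `[-q, q]`, which is ordinary division applied to `n + q`.
-/
theorem sum_Icc_blocks (q k : ℕ) (f : ℤ → ℝ) :
    ∑ x ∈ Finset.Icc (-((2 * q + 1) * k + q : ℤ)) ((2 * q + 1) * k + q), f x =
      ∑ y ∈ Finset.Icc (-(k : ℤ)) k, ∑ r ∈ Finset.Icc (-(q : ℤ)) q, f ((2 * q + 1) * y + r) := by
  rw [← Finset.sum_product']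
  symm
  have hp : (0 : ℤ) < 2 * q + 1 := by positivity
  refine Finset.sum_bij' (fun i _ => (2 * q + 1) * i.1 + i.2)
    (fun n _ => ((n + q) / (2 * q + 1), (n + q) % (2 * q + 1) - q)) ?_ ?_ ?_ ?_ ?_
  · rintro ⟨y, r⟩ h
    simp only [Finset.mem_product, Finset.mem_Icc] at h ⊢
    constructor <;> nlinarith
  · intro n h
    simp only [Finset.mem_product, Finset.mem_Icc] at h ⊢
    have h1 := Int.emod_nonneg (n + q) hp.ne'
    have h2 := Int.emod_lt_of_pos (n + q) hp
    refine ⟨⟨?_, ?_⟩, by omega, by omega⟩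
    · rw [Int.le_ediv_iff_mul_le hp]; nlinarith
    · rw [← Int.lt_add_one_iff, Int.ediv_lt_iff_lt_mul hp]; nlinarith
  · rintro ⟨y, r⟩ h
    simp only [Finset.mem_product, Finset.mem_Icc] at h
    have e : (2 * q + 1) * y + r + q = (r + q) + (2 * q + 1) * y := by ring
    have h0 : (r + q) / (2 * q + 1) = 0 := Int.ediv_eq_zero_of_lt (by omega) (by omega)
    have h1 : (r + q) % (2 * q + 1) = r + q := Int.emod_eq_of_lt (by omega) (by omega)
    simp only [e, Int.add_mul_ediv_left _ _ hp.ne', Int.add_mul_emod_self_left, h0, h1]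
    ext <;> simp
  · intro n h
    have := Int.mul_ediv_add_emod (n + q) (2 * q + 1)
    simp only
    linarith
  · intros; rfl

/-- A square of side `(2q+1)(2k+1)` splits into translates of the square of side `2q+1`. -/
theorem squareSum_blocks (τ : Site → ℝ) (q k : ℕ) :
    squareSum τ ((2 * q + 1) * k + q) =
      ∑ y ∈ square k, ∑ r ∈ square q, τ ((2 * q + 1) * y.1 + r.1, (2 * q + 1) * y.2 + r.2) := by
  simp only [squareSum, square, Finset.sum_product]
  push_cast
  rw [sum_Icc_blocks]
  refine Finset.sum_congr rfl fun y _ => ?_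
  rw [Finset.sum_comm]
  rw [sum_Icc_blocks]
  refine Finset.sum_congr rfl fun y' _ => Finset.sum_comm

theorem toPlane_norm_sq (x : Site) : ‖toPlane x‖ ^ 2 = (x.1 : ℝ) ^ 2 + (x.2 : ℝ) ^ 2 := by
  simp [toPlane, EuclideanSpace.norm_sq_eq, Fin.sum_univ_two]

theorem abs_fst_le_norm (x : Site) : |(x.1 : ℝ)| ≤ ‖toPlane x‖ := by
  refine abs_le_of_sq_le_sq ?_ (norm_nonneg _)
  rw [toPlane_norm_sq]; nlinarith [sq_nonneg (x.2 : ℝ)]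

theorem abs_snd_le_norm (x : Site) : |(x.2 : ℝ)| ≤ ‖toPlane x‖ := by
  refine abs_le_of_sq_le_sq ?_ (norm_nonneg _)
  rw [toPlane_norm_sq]; nlinarith [sq_nonneg (x.1 : ℝ)]

/-- Each coordinate of the rescaled offset is at most `q / (2q + 1) ≤ 1 / 2`. So `y` is an
admissible `x_ε` for every site `x` of its block, with `ε = 1 / (2q + 1)`. -/
theorem norm_block_le {q : ℕ} {y r : Site} (hr : r ∈ square q) :
    ‖toPlane y - (1 / (2 * q + 1 : ℝ)) •
      toPlane ((2 * q + 1) * y.1 + r.1, (2 * q + 1) * y.2 + r.2)‖ ≤ 1 / Real.sqrt 2 := by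
  have hp : (0 : ℝ) < 2 * q + 1 := by positivity
  rw [mem_square] at hr
  have hr1 : |(r.1 : ℝ)| ≤ q := by rw [abs_le]; exact_mod_cast hr.1
  have hr2 : |(r.2 : ℝ)| ≤ q := by rw [abs_le]; exact_mod_cast hr.2
  refine (sq_le_sq₀ (norm_nonneg _) (by positivity)).1 ?_
  rw [EuclideanSpace.norm_sq_eq, Fin.sum_univ_two, div_pow, Real.sq_sqrt (by norm_num)]
  have e1 : (toPlane y - (1 / (2 * q + 1 : ℝ)) •
      toPlane ((2 * q + 1) * y.1 + r.1, (2 * q + 1) * y.2 + r.2)) 0 = -(r.1 / (2 * q + 1)) := by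
    simp [toPlane]; field_simp; ring
  have e2 : (toPlane y - (1 / (2 * q + 1 : ℝ)) •
      toPlane ((2 * q + 1) * y.1 + r.1, (2 * q + 1) * y.2 + r.2)) 1 = -(r.2 / (2 * q + 1)) := by
    simp [toPlane]; field_simp; ring
  have b1 : |(r.1 / (2 * q + 1) : ℝ)| ≤ 1 / 2 := by
    rw [abs_div, abs_of_pos hp, div_le_div_iff₀ hp (by norm_num)]; linarith
  have b2 : |(r.2 / (2 * q + 1) : ℝ)| ≤ 1 / 2 := by
    rw [abs_div, abs_of_pos hp, div_le_div_iff₀ hp (by norm_num)]; linarith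
  rw [e1, e2, norm_neg, norm_neg, Real.norm_eq_abs, Real.norm_eq_abs]
  nlinarith [abs_nonneg (r.1 / (2 * q + 1) : ℝ), abs_nonneg (r.2 / (2 * q + 1) : ℝ)]

/-- Some coordinate of `y` has modulus at least `j + 1`, and `(2q + 1)(j + 1) - q ≥ j`. This places
whole blocks in the range where the comparison holds. -/
theorem le_norm_block {q j : ℕ} {y r : Site} (hy : y ∉ square j) (hr : r ∈ square q) :
    (j : ℝ) ≤ ‖toPlane ((2 * q + 1) * y.1 + r.1, (2 * q + 1) * y.2 + r.2)‖ := by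
  rw [mem_square] at *
  have key : ∀ u s : ℤ, ¬ (-(j : ℤ) ≤ u ∧ u ≤ j) → (-(q : ℤ) ≤ s ∧ s ≤ q) →
      (j : ℝ) ≤ |(((2 * q + 1) * u + s : ℤ) : ℝ)| := by
    intro u s hu hs
    rw [← Int.cast_abs]
    have : (j : ℤ) ≤ |(2 * q + 1) * u + s| := by
      rw [le_abs]
      rcases not_and_or.1 hu with h | h
      · right; push Not at h; nlinarith
      · left; push Not at h; nlinarith
    exact_mod_cast this
  rcases not_and_or.1 hy with h | h
  · exact (key _ _ h hr.1).trans (abs_fst_le_norm (_, _))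
  · exact (key _ _ h hr.2).trans (abs_snd_le_norm (_, _))

/-! ### Growth of the square sums -/

/-- The lower power-law comparison in terms of sums over squares. -/
theorem exists_squareSum_growth {τ : Site → ℝ} {θ : ℝ} (hyp : PowerLawComparison τ θ) :
    ∃ K > (0 : ℝ), ∀ᶠ q : ℕ in atTop, ∃ R : ℕ, ∀ j k : ℕ, R ≤ j → j ≤ k →
      K * (2 * q + 1 : ℝ) ^ (2 * (1 - θ)) * (squareSum τ k - squareSum τ j) ≤
        squareSum τ ((2 * q + 1) * k + q) - squareSum τ ((2 * q + 1) * j + q) := by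
  obtain ⟨K₁, hK₁, K₂, h⟩ := hyp
  refine ⟨K₁, hK₁, ?_⟩
  have ht : Tendsto (fun q : ℕ => (1 / (2 * q + 1 : ℝ))) atTop (𝓝[>] 0) := by
    refine tendsto_nhdsWithin_iff.2 ⟨?_, Eventually.of_forall fun q => ?_⟩
    · refine squeeze_zero (fun q => by positivity) (fun q => ?_)
        tendsto_one_div_add_atTop_nhds_zero_nat
      refine one_div_le_one_div_of_le (by positivity) ?_
      linarith [(Nat.cast_nonneg q : (0 : ℝ) ≤ q)]
    · simp only [Set.mem_Ioi]; positivity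
  filter_upwards [ht.eventually h] with q ⟨R, hR⟩
  have hp : (0 : ℝ) < 2 * q + 1 := by positivity
  obtain ⟨R', hR'⟩ := exists_nat_ge R
  refine ⟨R', fun j k hj hjk => ?_⟩
  -- Differences of square sums keep only the blocks with `y` outside `square j`, all of whose sites
  -- have norm at least `R`.
  rw [squareSum_blocks, squareSum_blocks, squareSum, squareSum,
    ← Finset.sum_sdiff (square_mono hjk), ← Finset.sum_sdiff (square_mono hjk), add_sub_cancel_right,
    add_sub_cancel_right, Finset.mul_sum]
  refine Finset.sum_le_sum fun y hy => ?_
  -- The exponent `2 (1 - θ)`: there are `(2q + 1) ^ 2` sites in a block, each bounded below with a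
  -- factor `(2q + 1) ^ (-2θ)`.
  have hc : ∑ r ∈ square q, K₁ * (1 / (2 * q + 1 : ℝ)) ^ (2 * θ) * τ y =
      K₁ * (2 * q + 1 : ℝ) ^ (2 * (1 - θ)) * τ y := by
    rw [Finset.sum_const, card_square, nsmul_eq_mul]
    have : (2 * q + 1 : ℝ) ^ (2 * (1 - θ)) =
        (2 * q + 1 : ℝ) ^ 2 * (1 / (2 * q + 1 : ℝ)) ^ (2 * θ) := by
      rw [mul_sub, mul_one, Real.rpow_sub hp, one_div, Real.inv_rpow hp.le, div_eq_mul_inv]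
      norm_num
    rw [this]; push_cast; ring
  rw [← hc]
  refine Finset.sum_le_sum fun r hr => ?_
  refine (hR _ ?_ y (norm_block_le hr)).2
  refine (hR'.trans ?_).trans (le_norm_block (Finset.mem_sdiff.1 hy).2 hr)
  exact_mod_cast hj

theorem tendsto_mul_odd_rpow {θ : ℝ} (hθ : θ < 1) {K : ℝ} (hK : 0 < K) :
    Tendsto (fun q : ℕ => K * (2 * q + 1 : ℝ) ^ (2 * (1 - θ))) atTop atTop := by
  refine Tendsto.const_mul_atTop hK ((tendsto_rpow_atTop (by linarith)).comp ?_)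
  exact tendsto_atTop_add_const_right _ _
    (tendsto_natCast_atTop_atTop.const_mul_atTop (by norm_num))

/-- Since `θ < 1`, some `q` has growth factor at least 2. A finite limit `l` would then satisfy `2
(l - S R) ≤ l - S R`, so `S` would be constant beyond `R`, against positivity on the axis. -/
theorem tendsto_squareSum_atTop {τ : Site → ℝ} {θ : ℝ} (hτ : ∀ z, 0 ≤ τ z)
    (hpos : ∀ k : ℕ, 0 < τ (k, 0)) (hθ : θ < 1) (hyp : PowerLawComparison τ θ) :
    Tendsto (squareSum τ) atTop atTop := by
  obtain ⟨K, hK, h⟩ := exists_squareSum_growth hyp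
  obtain ⟨q, ⟨R, hR⟩, hq⟩ :=
    (h.and ((tendsto_mul_odd_rpow hθ hK).eventually_ge_atTop 2)).exists
  rcases tendsto_atTop_of_monotone (squareSum_mono hτ) with h | ⟨l, hl⟩
  · exact h
  exfalso
  have hle : ∀ k, squareSum τ k ≤ l := (squareSum_mono hτ).ge_of_tendsto hl
  have h1 : ∀ k, R ≤ k → 2 * (squareSum τ k - squareSum τ R) ≤ l - squareSum τ R := by
    intro k hk
    have h2 := hR R k le_rfl hk
    have h3 := squareSum_mono hτ (show R ≤ (2 * q + 1) * R + q by nlinarith)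
    have h4 := squareSum_mono hτ hk
    have h5 := hle ((2 * q + 1) * k + q)
    nlinarith
  have h2 : 2 * (l - squareSum τ R) ≤ l - squareSum τ R :=
    le_of_tendsto ((hl.sub_const _).const_mul 2) (eventually_atTop.2 ⟨R, h1⟩)
  have h3 : squareSum τ R + τ ((R + 1 : ℕ), 0) ≤ squareSum τ (R + 1) := by
    have hn : (((R + 1 : ℕ) : ℤ), (0 : ℤ)) ∉ square R := by rw [mem_square]; push_cast; omega
    rw [squareSum, squareSum, add_comm, ← Finset.sum_insert hn]
    refine Finset.sum_le_sum_of_subset_of_nonneg ?_ fun z _ _ => hτ z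
    refine Finset.insert_subset ?_ (square_mono (Nat.le_succ R))
    rw [mem_square]; push_cast; omega
  linarith [hle (R + 1), hpos (R + 1)]

/-- As the square sums diverge, the subtracted term at `R` is eventually at most half of the sum;
this costs a factor 2 in the constant. -/
theorem exists_eventually_squareSum_le {τ : Site → ℝ} {θ : ℝ} (hτ : ∀ z, 0 ≤ τ z)
    (hpos : ∀ k : ℕ, 0 < τ (k, 0)) (hθ : θ < 1) (hyp : PowerLawComparison τ θ) :
    ∃ K > (0 : ℝ), ∀ᶠ q : ℕ in atTop, ∀ᶠ k : ℕ in atTop,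
      K * (2 * q + 1 : ℝ) ^ (2 * (1 - θ)) * squareSum τ k ≤ squareSum τ ((2 * q + 1) * k + q) := by
  have hlim := tendsto_squareSum_atTop hτ hpos hθ hyp
  obtain ⟨K, hK, h⟩ := exists_squareSum_growth hyp
  refine ⟨K / 2, by positivity, ?_⟩
  filter_upwards [h] with q ⟨R, hR⟩
  filter_upwards [eventually_ge_atTop R, hlim.eventually_ge_atTop (2 * squareSum τ R)] with k hk hk'
  have h1 := hR R k le_rfl hk
  have h2 : 0 ≤ squareSum τ ((2 * q + 1) * R + q) := Finset.sum_nonneg fun z _ => hτ z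
  have h3 : 0 ≤ K * (2 * q + 1 : ℝ) ^ (2 * (1 - θ)) := by positivity
  nlinarith

/-! ### Sums over pairs of sites of a box -/

/-- The sum of `τ (y - x)` over pairs of sites of `A` at sup-distance at most `m` is at most the
number of sites times the sum of `τ` over a square. -/
theorem sum_box_le {τ : Site → ℝ} (hτ : ∀ z, 0 ≤ τ z) (A : Finset Site) (m : ℕ)
    (p : Site → Site → Prop) [DecidableRel p] (hp : ∀ x y, p x y → y - x ∈ square m) :
    ∑ x ∈ A, ∑ y ∈ A with p x y, τ (y - x) ≤ A.card * squareSum τ m := by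
  rw [← nsmul_eq_mul]
  refine Finset.sum_le_card_nsmul _ _ _ fun x _ => ?_
  rw [squareSum, ← Finset.sum_image (g := fun y => y - x) (f := τ)
    (fun y _ y' _ h => sub_left_injective h)]
  refine Finset.sum_le_sum_of_subset_of_nonneg ?_ fun z _ _ => hτ z
  intro z hz
  obtain ⟨y, hy, rfl⟩ := Finset.mem_image.1 hz
  exact hp _ _ (Finset.mem_filter.1 hy).2

theorem card_Icc_inter_shift (L m : ℕ) (hm : 2 * m ≤ L) (z : ℤ) (hz : -(m : ℤ) ≤ z ∧ z ≤ m) :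
    L + 1 ≤ 2 * ((Finset.Icc (0 : ℤ) L).filter fun x => x + z ∈ Finset.Icc (0 : ℤ) L).card := by
  have : (Finset.Icc (0 : ℤ) L).filter (fun x => x + z ∈ Finset.Icc (0 : ℤ) L) =
      Finset.Icc (max 0 (-z)) (min L (L - z)) := by
    ext x; simp only [Finset.mem_filter, Finset.mem_Icc]; omega
  rw [this, Int.card_Icc]
  omega

/-- A shift by `z` with coordinates at most `L / 2` in modulus keeps at least half of the positions
in each coordinate, hence a quarter of the sites. -/
theorem le_sum_box {τ : Site → ℝ} (hτ : ∀ z, 0 ≤ τ z) (L m : ℕ) (hm : 2 * m ≤ L) :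
    ((Finset.Icc (0 : ℤ) L ×ˢ Finset.Icc (0 : ℤ) L).card : ℝ) * squareSum τ m ≤
      4 * ∑ x ∈ Finset.Icc (0 : ℤ) L ×ˢ Finset.Icc (0 : ℤ) L,
        ∑ y ∈ Finset.Icc (0 : ℤ) L ×ˢ Finset.Icc (0 : ℤ) L, τ (y - x) := by
  set A := Finset.Icc (0 : ℤ) L ×ˢ Finset.Icc (0 : ℤ) L with hA
  have h1 : ∑ x ∈ A, ∑ z ∈ square m with x + z ∈ A, τ z ≤ ∑ x ∈ A, ∑ y ∈ A, τ (y - x) := by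
    refine Finset.sum_le_sum fun x _ => ?_
    rw [← Finset.sum_image (s := A) (g := fun y => y - x) (f := τ)
      (fun y _ y' _ h => sub_left_injective h)]
    refine Finset.sum_le_sum_of_subset_of_nonneg ?_ fun z _ _ => hτ z
    intro z hz
    exact Finset.mem_image.2 ⟨x + z, (Finset.mem_filter.1 hz).2, by simp⟩
  have h2 : ∑ x ∈ A, ∑ z ∈ square m with x + z ∈ A, τ z =
      ∑ z ∈ square m, ((A.filter fun x => x + z ∈ A).card : ℝ) * τ z := by
    simp_rw [Finset.sum_filter]
    rw [Finset.sum_comm]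
    refine Finset.sum_congr rfl fun z _ => ?_
    rw [← Finset.sum_filter, Finset.sum_const, nsmul_eq_mul]
  have h3 : ∀ z ∈ square m, A.card ≤ 4 * (A.filter fun x => x + z ∈ A).card := by
    intro z hz
    rw [mem_square] at hz
    have e : A.filter (fun x => x + z ∈ A) =
        ((Finset.Icc (0 : ℤ) L).filter fun x => x + z.1 ∈ Finset.Icc (0 : ℤ) L) ×ˢ
          ((Finset.Icc (0 : ℤ) L).filter fun x => x + z.2 ∈ Finset.Icc (0 : ℤ) L) := by
      ext x; simp only [hA, Finset.mem_filter, Finset.mem_product, Prod.fst_add, Prod.snd_add]; tauto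
    have c1 := card_Icc_inter_shift L m hm z.1 hz.1
    have c2 := card_Icc_inter_shift L m hm z.2 hz.2
    have c0 : A.card = (L + 1) * (L + 1) := by simp [hA]
    rw [c0, e, Finset.card_product]
    nlinarith
  calc (A.card : ℝ) * squareSum τ m
      = ∑ z ∈ square m, (A.card : ℝ) * τ z := by rw [squareSum, Finset.mul_sum]
    _ ≤ ∑ z ∈ square m, 4 * (((A.filter fun x => x + z ∈ A).card : ℝ) * τ z) := by
        refine Finset.sum_le_sum fun z hz => ?_
        rw [← mul_assoc]
        exact mul_le_mul_of_nonneg_right (by exact_mod_cast h3 z hz) (hτ z)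
    _ ≤ _ := by
        rw [← Finset.mul_sum, ← h2]; linarith

/-! ### Uniqueness of the Gibbs distribution at high temperature -/

theorem measurable_spin (x : Site) : Measurable fun σ : SpinConfig => spin σ x :=
  (measurable_of_countable fun b : Bool => if b then (1 : ℝ) else -1).comp (measurable_pi_apply x)

theorem spin_eq_or (σ : SpinConfig) (x : Site) : spin σ x = 1 ∨ spin σ x = -1 := by
  unfold spin; split_ifs <;> simp

theorem spin_mul_self (σ : SpinConfig) (x : Site) : spin σ x * spin σ x = 1 := by
  rcases spin_eq_or σ x with h | h <;> simp [h]

/-- The product of the spins in a finite set. -/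
def spinProd (A : Finset Site) (σ : SpinConfig) : ℝ := ∏ x ∈ A, spin σ x

theorem measurable_spinProd (A : Finset Site) : Measurable (spinProd A) :=
  Finset.measurable_fun_prod _ fun x _ => measurable_spin x

theorem spinProd_eq_or (A : Finset Site) (σ : SpinConfig) :
    spinProd A σ = 1 ∨ spinProd A σ = -1 := by
  unfold spinProd
  induction A using Finset.induction_on with
  | empty => simp
  | insert x A hx ih =>
    rw [Finset.prod_insert hx]
    rcases ih with h | h <;> rcases spin_eq_or σ x with h' | h' <;> simp [h, h']

theorem abs_spinProd (A : Finset Site) (σ : SpinConfig) : |spinProd A σ| = 1 := by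
  rcases spinProd_eq_or A σ with h | h <;> simp [h]

theorem integrable_spinProd (μ : Measure SpinConfig) [IsFiniteMeasure μ] (A : Finset Site) :
    Integrable (spinProd A) μ :=
  .of_bound (measurable_spinProd A).aestronglyMeasurable 1
    (Eventually.of_forall fun σ => by rw [Real.norm_eq_abs, abs_spinProd])

theorem exists_spin_mul_spinProd (y : Site) (A : Finset Site) :
    ∃ A' : Finset Site, ∀ σ, spin σ y * spinProd A σ = spinProd A' σ := by
  by_cases h : y ∈ A
  · refine ⟨A.erase y, fun σ => ?_⟩
    rw [spinProd, ← Finset.mul_prod_erase A _ h, ← mul_assoc, spin_mul_self, one_mul, spinProd]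
  · exact ⟨insert y A, fun σ => by rw [spinProd, spinProd, Finset.prod_insert h]⟩

/-- The four neighbours of a site. -/
def nbr (x : Site) : Fin 4 → Site := ![x + (1, 0), x + (0, 1), x - (1, 0), x - (0, 1)]

/-- The sum of the spins at the neighbours of `x`. -/
def localField (σ : SpinConfig) (x : Site) : ℝ := ∑ i, spin σ (nbr x i)

theorem bondsTouching_singleton (x : Site) :
    bondsTouching {x} = {(x, 0), (x, 1), (x - (1, 0), 0), (x - (0, 1), 1)} := by
  ext ⟨y, i⟩
  rw [mem_bondsTouching]
  fin_cases i <;> simp [Bond.src, Bond.tgt, eq_sub_iff_add_eq]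

theorem nbr_ne (x : Site) (i : Fin 4) : nbr x i ≠ x := by
  fin_cases i <;> simp [nbr]

theorem energy_touching_singleton (x : Site) (σ : SpinConfig) :
    energy (bondsTouching {x}) σ = -(spin σ x * localField σ x) := by
  rw [bondsTouching_singleton, energy, Finset.sum_insert, Finset.sum_insert, Finset.sum_insert,
    Finset.sum_singleton]
  · simp [Bond.src, Bond.tgt, localField, Fin.sum_univ_four, nbr]; ring
  all_goals simp [Prod.ext_iff] <;> omega

theorem glue_singleton (x : Site) (s : ({x} : Finset Site) → Bool) (η : SpinConfig) :
    glue {x} s η = Function.update η x (s ⟨x, Finset.mem_singleton_self x⟩) := by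
  funext y
  by_cases h : y = x
  · subst h; simp [glue]
  · simp [glue, h]

theorem localField_update (η : SpinConfig) (x : Site) (b : Bool) :
    localField (Function.update η x b) x = localField η x := by
  simp [localField, spin, nbr_ne]

theorem spinProd_update {A : Finset Site} {x : Site} (hx : x ∉ A) (η : SpinConfig) (b : Bool) :
    spinProd A (Function.update η x b) = spinProd A η := by
  refine Finset.prod_congr rfl fun y hy => ?_
  have : y ≠ x := fun h => hx (h ▸ hy)
  simp [spin, this]

theorem sum_singleton_config {M : Type*} [AddCommMonoid M] (x : Site) (f : Bool → M) :
    ∑ s : ({x} : Finset Site) → Bool, f (s ⟨x, Finset.mem_singleton_self x⟩) =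
      f true + f false := by
  rw [← Fintype.sum_bool f]
  exact Fintype.sum_equiv (Equiv.funUnique ({x} : Finset Site) Bool) _ _ fun s => rfl

theorem gibbsKernel_singleton (β : ℝ) (x : Site) (η : SpinConfig) :
    gibbsKernel β {x} η =
      (ENNReal.ofReal (Real.exp (β * localField η x)) +
          ENNReal.ofReal (Real.exp (-(β * localField η x))))⁻¹ •
        (ENNReal.ofReal (Real.exp (β * localField η x)) •
            Measure.dirac (Function.update η x true) +
          ENNReal.ofReal (Real.exp (-(β * localField η x))) •
            Measure.dirac (Function.update η x false)) := by
  simp only [gibbsKernel, glue_singleton, energy_touching_singleton, localField_update]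
  rw [sum_singleton_config x fun b => ENNReal.ofReal (Real.exp (-β *
      -(spin (Function.update η x b) x * localField η x))),
    sum_singleton_config x fun b => ENNReal.ofReal (Real.exp (-β *
      -(spin (Function.update η x b) x * localField η x))) •
        Measure.dirac (Function.update η x b)]
  simp [spin]

/-- The DLR equations concern probabilities of events, so a `±1`-valued product is handled through
the event that it equals 1. -/
theorem gibbsKernel_singleton_apply (β : ℝ) {x : Site} {A : Finset Site} (hx : x ∉ A)
    (η : SpinConfig) :
    gibbsKernel β {x} η {σ | spinProd (insert x A) σ = 1} =
      ENNReal.ofReal ((1 + spinProd A η * Real.tanh (β * localField η x)) / 2) := by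
  have hm : MeasurableSet {σ | spinProd (insert x A) σ = 1} :=
    measurable_spinProd _ (measurableSet_singleton 1)
  rw [gibbsKernel_singleton]
  simp only [Measure.smul_apply, Measure.add_apply, Measure.dirac_apply' _ hm, smul_eq_mul]
  set h := β * localField η x
  have e : ∀ b, spinProd (insert x A) (Function.update η x b) =
      (if b then 1 else -1) * spinProd A η := by
    intro b
    have := spinProd_update hx η b
    rw [spinProd] at this ⊢
    rw [Finset.prod_insert hx, this]
    simp [spin]
  have hp := Real.exp_pos h
  have hn := Real.exp_pos (-h)
  rw [← ENNReal.ofReal_add hp.le hn.le, ← ENNReal.ofReal_inv_of_pos (by positivity)]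
  rcases spinProd_eq_or A η with hA | hA
  · have h1 : Function.update η x true ∈ {σ | spinProd (insert x A) σ = 1} := by simp [e, hA]
    have h2 : Function.update η x false ∉ {σ | spinProd (insert x A) σ = 1} := by
      simp [e, hA]; norm_num
    rw [Set.indicator_of_mem h1, Set.indicator_of_notMem h2, hA, mul_zero, add_zero, Pi.one_apply,
      mul_one, ← ENNReal.ofReal_mul (by positivity), Real.tanh_eq]
    congr 1; field_simp; ring
  · have h1 : Function.update η x true ∉ {σ | spinProd (insert x A) σ = 1} := by
      simp [e, hA]; norm_num
    have h2 : Function.update η x false ∈ {σ | spinProd (insert x A) σ = 1} := by simp [e, hA]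
    rw [Set.indicator_of_notMem h1, Set.indicator_of_mem h2, hA, mul_zero, zero_add, Pi.one_apply,
      mul_one, ← ENNReal.ofReal_mul (by positivity), Real.tanh_eq]
    congr 1; field_simp; ring

theorem continuous_tanh : Continuous Real.tanh := by
  rw [show Real.tanh = fun x => Real.sinh x / Real.cosh x from funext Real.tanh_eq_sinh_div_cosh]
  exact Real.continuous_sinh.div Real.continuous_cosh fun x => (Real.cosh_pos x).ne'

theorem abs_tanh_le_one (t : ℝ) : |Real.tanh t| ≤ 1 :=
  abs_le.2 ⟨(Real.neg_one_lt_tanh t).le, (Real.tanh_lt_one t).le⟩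

theorem measurable_localField (x : Site) : Measurable fun σ => localField σ x :=
  Finset.measurable_fun_sum _ fun _ _ => measurable_spin _

/-- Given all other spins, the spin at `x` has mean `tanh (β * localField)`. -/
theorem IsGibbs.integral_spinProd_insert {β : ℝ} {μ : Measure SpinConfig} (hμ : IsGibbs β μ)
    {x : Site} {A : Finset Site} (hx : x ∉ A) :
    ∫ σ, spinProd (insert x A) σ ∂μ =
      ∫ σ, spinProd A σ * Real.tanh (β * localField σ x) ∂μ := by
  have := hμ.1
  have hm : MeasurableSet {σ | spinProd (insert x A) σ = 1} :=
    measurable_spinProd _ (measurableSet_singleton 1)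
  have h1 := hμ.2 {x} _ hm
  simp_rw [gibbsKernel_singleton_apply β hx] at h1
  have hmt : Measurable fun σ => spinProd A σ * Real.tanh (β * localField σ x) :=
    (measurable_spinProd A).mul (continuous_tanh.measurable.comp
      ((measurable_localField x).const_mul β))
  have hb : ∀ σ, |spinProd A σ * Real.tanh (β * localField σ x)| ≤ 1 := by
    intro σ; rw [abs_mul, abs_spinProd, one_mul]; exact abs_tanh_le_one _
  have hint : Integrable (fun σ => spinProd A σ * Real.tanh (β * localField σ x)) μ :=
    .of_bound hmt.aestronglyMeasurable 1 (Eventually.of_forall hb)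
  rw [← ofReal_integral_eq_lintegral_ofReal] at h1
  · have h2 : μ.real {σ | spinProd (insert x A) σ = 1} =
        ∫ σ, (1 + spinProd A σ * Real.tanh (β * localField σ x)) / 2 ∂μ := by
      rw [Measure.real, ← h1, ENNReal.toReal_ofReal]
      refine integral_nonneg fun σ => ?_
      have := (abs_le.1 (hb σ)).1
      simp only [Pi.zero_apply]; linarith
    have h3 : ∀ σ, spinProd (insert x A) σ =
        2 * ({σ | spinProd (insert x A) σ = 1}.indicator 1 σ) - 1 := by
      intro σ
      rcases spinProd_eq_or (insert x A) σ with h | h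
      · rw [Set.indicator_of_mem (by exact h), h]; norm_num
      · rw [Set.indicator_of_notMem (by simp [h]; norm_num), h]; norm_num
    rw [integral_congr_ae (Eventually.of_forall h3), integral_sub, integral_const_mul,
      integral_indicator_one hm, h2, integral_div, integral_add (integrable_const _) hint]
    · simp; ring
    · exact ((integrable_const (1 : ℝ)).indicator hm).const_mul 2
    · exact integrable_const _
  · exact ((integrable_const _).add hint).div_const 2
  · refine Eventually.of_forall fun σ => ?_
    have := (abs_le.1 (hb σ)).1
    simp only [Pi.zero_apply]; linarith

/-- The local field takes only the values 0, ±2, ±4, so the odd cubic interpolating at 2 and 4 is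
exact. -/
theorem tanh_localField (β : ℝ) (σ : SpinConfig) (x : Site) :
    Real.tanh (β * localField σ x) =
      (Real.tanh (2 * β) * 2 / 3 - Real.tanh (4 * β) / 12) * localField σ x +
      (Real.tanh (4 * β) - 2 * Real.tanh (2 * β)) / 48 * localField σ x ^ 3 := by
  have n2 : β * -2 = -(2 * β) := by ring
  have n4 : β * -4 = -(4 * β) := by ring
  have p2 : β * 2 = 2 * β := by ring
  have p4 : β * 4 = 4 * β := by ring
  rw [localField, Fin.sum_univ_four]
  rcases spin_eq_or σ (nbr x 0) with h0 | h0 <;> rcases spin_eq_or σ (nbr x 1) with h1 | h1 <;>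
  rcases spin_eq_or σ (nbr x 2) with h2 | h2 <;> rcases spin_eq_or σ (nbr x 3) with h3 | h3 <;>
  rw [h0, h1, h2, h3] <;> norm_num [n2, n4, p2, p4, Real.tanh_neg] <;> ring

theorem spinProd_mul_tanh (β : ℝ) (A : Finset Site) (x : Site) :
    ∃ (B : Fin 4 → Finset Site) (C : Fin 4 → Fin 4 → Fin 4 → Finset Site), ∀ σ,
      spinProd A σ * Real.tanh (β * localField σ x) =
      (Real.tanh (2 * β) * 2 / 3 - Real.tanh (4 * β) / 12) * ∑ i, spinProd (B i) σ +
      (Real.tanh (4 * β) - 2 * Real.tanh (2 * β)) / 48 * ∑ i, ∑ j, ∑ k, spinProd (C i j k) σ := by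
  choose f hf using exists_spin_mul_spinProd
  refine ⟨fun i => f (nbr x i) A, fun i j k => f (nbr x i) (f (nbr x j) (f (nbr x k) A)),
    fun σ => ?_⟩
  simp_rw [← hf, tanh_localField]
  have h3 : localField σ x ^ 3 * spinProd A σ = ∑ i, ∑ j, ∑ k, spin σ (nbr x i) *
      (spin σ (nbr x j) * (spin σ (nbr x k) * spinProd A σ)) := by
    simp_rw [← Finset.mul_sum, ← Finset.sum_mul, localField]
    ring
  rw [← h3, ← Finset.sum_mul, localField]
  ring

/-- Averaging over one spin of `A` writes its correlation as a combination of 4 + 64 other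
correlations, with coefficients common to all Gibbs distributions. For small `β` this is a
contraction in the supremum over all `A`. -/
theorem IsGibbs.abs_integral_spinProd_sub_le {β : ℝ} (h2 : |Real.tanh (2 * β)| ≤ 1 / 100)
    (h4 : |Real.tanh (4 * β)| ≤ 1 / 100) {μ ν : Measure SpinConfig} (hμ : IsGibbs β μ)
    (hν : IsGibbs β ν) (n : ℕ) (A : Finset Site) :
    |∫ σ, spinProd A σ ∂μ - ∫ σ, spinProd A σ ∂ν| ≤ 2 * (1 / 2) ^ n := by
  have := hμ.1
  have := hν.1
  induction n generalizing A with
  | zero =>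
    have key : ∀ (ρ : Measure SpinConfig) [IsProbabilityMeasure ρ], |∫ σ, spinProd A σ ∂ρ| ≤ 1 := by
      intro ρ _
      have := norm_integral_le_of_norm_le_const (μ := ρ) (f := spinProd A) (C := 1)
        (Eventually.of_forall fun σ => by rw [Real.norm_eq_abs, abs_spinProd])
      simpa using this
    have a := abs_le.1 (key μ)
    have b := abs_le.1 (key ν)
    rw [abs_le]; constructor <;> linarith
  | succ n ih =>
    rcases A.eq_empty_or_nonempty with rfl | ⟨x, hx⟩
    · simp [spinProd]
    obtain ⟨B, C, hBC⟩ := spinProd_mul_tanh β (A.erase x) x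
    set a := Real.tanh (2 * β) * 2 / 3 - Real.tanh (4 * β) / 12 with ha
    set b := (Real.tanh (4 * β) - 2 * Real.tanh (2 * β)) / 48 with hb
    have key : ∀ ρ : Measure SpinConfig, IsGibbs β ρ → ∫ σ, spinProd A σ ∂ρ =
        a * ∑ i, ∫ σ, spinProd (B i) σ ∂ρ +
          b * ∑ i, ∑ j, ∑ k, ∫ σ, spinProd (C i j k) σ ∂ρ := by
      intro ρ hρ
      have := hρ.1
      have hi := integrable_spinProd ρ
      rw [← Finset.insert_erase hx, hρ.integral_spinProd_insert (Finset.notMem_erase x A)]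
      simp_rw [hBC]
      rw [integral_add, integral_const_mul, integral_const_mul, integral_finsetSum _ fun _ _ => hi _,
        integral_finsetSum]
      · congr 2
        refine Finset.sum_congr rfl fun i _ => ?_
        rw [integral_finsetSum]
        · refine Finset.sum_congr rfl fun j _ => ?_
          rw [integral_finsetSum _ fun _ _ => hi _]
        · exact fun j _ => integrable_finsetSum _ fun k _ => hi _
      · exact fun i _ => integrable_finsetSum _ fun j _ => integrable_finsetSum _ fun k _ => hi _
      · exact (integrable_finsetSum _ fun k _ => hi _).const_mul _
      · exact (integrable_finsetSum _ fun i _ => integrable_finsetSum _ fun j _ =>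
          integrable_finsetSum _ fun k _ => hi _).const_mul _
    set D : ℝ := 2 * (1 / 2) ^ n with hD
    have hD0 : 0 ≤ D := by positivity
    rw [key μ hμ, key ν hν]
    have e : ∀ p q r s : ℝ, a * p + b * q - (a * r + b * s) = a * (p - r) + b * (q - s) := by
      intros; ring
    rw [e]
    simp_rw [← Finset.sum_sub_distrib]
    have s1 : |∑ i, (∫ σ, spinProd (B i) σ ∂μ - ∫ σ, spinProd (B i) σ ∂ν)| ≤ 4 * D := by
      refine (Finset.abs_sum_le_sum_abs _ _).trans ?_
      refine (Finset.sum_le_card_nsmul _ _ D fun i _ => ih _).trans ?_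
      simp
    have s2 : |∑ i, ∑ j, ∑ k, (∫ σ, spinProd (C i j k) σ ∂μ - ∫ σ, spinProd (C i j k) σ ∂ν)| ≤
        64 * D := by
      refine (Finset.abs_sum_le_sum_abs _ _).trans ?_
      refine (Finset.sum_le_card_nsmul _ _ (16 * D) fun i _ => ?_).trans (by simp; linarith)
      refine (Finset.abs_sum_le_sum_abs _ _).trans ?_
      refine (Finset.sum_le_card_nsmul _ _ (4 * D) fun j _ => ?_).trans (by simp; linarith)
      refine (Finset.abs_sum_le_sum_abs _ _).trans ?_
      exact (Finset.sum_le_card_nsmul _ _ D fun k _ => ih _).trans (by simp)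
    have ha' : |a| ≤ 1 / 100 := by
      rw [abs_le] at h2 h4 ⊢; rw [ha]; constructor <;> linarith
    have hb' : |b| ≤ 1 / 1000 := by
      rw [abs_le] at h2 h4 ⊢; rw [hb]; constructor <;> linarith
    calc _ ≤ |a| * _ + |b| * _ := (abs_add_le _ _).trans (by rw [abs_mul, abs_mul])
      -- The contraction factor is `4 / 100 + 64 / 1000`, below `1 / 2`.
      _ ≤ 1 / 100 * (4 * D) + 1 / 1000 * (64 * D) := by gcongr
      _ ≤ 2 * (1 / 2) ^ (n + 1) := by rw [pow_succ]; linarith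

/-- Probability measures on spin configurations are determined by the expectations of products of
spins. -/
theorem ext_of_integral_spinProd {μ ν : Measure SpinConfig} [IsProbabilityMeasure μ]
    [IsProbabilityMeasure ν] (h : ∀ A, ∫ σ, spinProd A σ ∂μ = ∫ σ, spinProd A σ ∂ν) : μ = ν := by
  let C : Set (Set SpinConfig) := Set.range fun A : Finset Site => {σ | ∀ x ∈ A, σ x = true}
  have hmeas : ∀ A : Finset Site, MeasurableSet {σ : SpinConfig | ∀ x ∈ A, σ x = true} := by
    intro A
    have : {σ : SpinConfig | ∀ x ∈ A, σ x = true} = ⋂ x ∈ A, {σ | σ x = true} := by ext; simp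
    rw [this]
    exact A.measurableSet_biInter fun x _ =>
      (measurable_pi_apply (X := fun _ : Site => Bool) x) (measurableSet_singleton true)
  refine ext_of_generate_finite C ?_ ?_ ?_ (by simp)
  · refine le_antisymm ?_ (MeasurableSpace.generateFrom_le ?_)
    · refine iSup_le fun x => Measurable.comap_le ?_
      refine @measurable_to_bool _ (MeasurableSpace.generateFrom C) _ ?_
      exact MeasurableSpace.measurableSet_generateFrom ⟨{x}, by ext; simp⟩
    · rintro _ ⟨A, rfl⟩
      exact hmeas A
  · rintro _ ⟨A, rfl⟩ _ ⟨B, rfl⟩ -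
    refine ⟨A ∪ B, ?_⟩
    ext σ
    simp only [Finset.mem_union, Set.mem_ofPred_eq, Set.mem_inter_iff]
    exact ⟨fun h => ⟨fun x hx => h x (.inl hx), fun x hx => h x (.inr hx)⟩,
      fun h x hx => hx.elim (h.1 x) (h.2 x)⟩
  · rintro _ ⟨A, rfl⟩
    -- The indicator that all spins of `A` are up is the product of the factors `(1 + S_x) / 2`,
    -- which expands over the subsets of `A`.
    have key : ∀ (ρ : Measure SpinConfig) [IsProbabilityMeasure ρ],
        ρ.real {σ | ∀ x ∈ A, σ x = true} =
          (1 / 2) ^ A.card * ∑ B ∈ A.powerset, ∫ σ, spinProd B σ ∂ρ := by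
      intro ρ _
      rw [← integral_indicator_one (hmeas A), ← integral_finsetSum _ fun B _ =>
        integrable_spinProd ρ B, ← integral_const_mul]
      congr 1
      funext σ
      have : ∑ B ∈ A.powerset, spinProd B σ = ∏ x ∈ A, (1 + spin σ x) := by
        rw [Finset.prod_one_add]; rfl
      rw [this, ← Finset.prod_const, ← Finset.prod_mul_distrib]
      by_cases hσ : ∀ x ∈ A, σ x = true
      · rw [Set.indicator_of_mem (by exact hσ)]
        symm
        exact Finset.prod_eq_one fun x hx => by simp [spin, hσ x hx]; norm_num
      · rw [Set.indicator_of_notMem (by exact hσ)]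
        push Not at hσ
        obtain ⟨x, hx, hσ⟩ := hσ
        exact (Finset.prod_eq_zero hx (by simp [spin, hσ])).symm
    refine (measureReal_eq_measureReal_iff).1 ?_
    rw [key μ, key ν]
    simp_rw [h]

theorem exists_pos_isGibbs_unique :
    ∃ δ > (0 : ℝ), ∀ β, 0 ≤ β → β < δ → ∀ μ ν, IsGibbs β μ → IsGibbs β ν → μ = ν := by
  have hc : ∀ c : ℝ, ∀ᶠ β in 𝓝 (0 : ℝ), |Real.tanh (c * β)| < 1 / 100 := by
    intro c
    have : Continuous fun β : ℝ => |Real.tanh (c * β)| :=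
      (continuous_tanh.comp (continuous_const.mul continuous_id)).abs
    exact this.continuousAt.eventually_lt continuousAt_const (by simp)
  obtain ⟨δ, hδ, h⟩ := Metric.eventually_nhds_iff.1 ((hc 2).and (hc 4))
  refine ⟨δ, hδ, fun β h0 hβ μ ν hμ hν => ?_⟩
  obtain ⟨h2, h4⟩ := h (y := β) (by rwa [Real.dist_eq, sub_zero, abs_of_nonneg h0])
  have := hμ.1
  have := hν.1
  refine ext_of_integral_spinProd fun A => ?_
  have ht : Tendsto (fun n : ℕ => 2 * (1 / 2 : ℝ) ^ n) atTop (𝓝 (2 * 0)) :=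
    (tendsto_pow_atTop_nhds_zero_of_lt_one (by norm_num) (by norm_num)).const_mul 2
  have := ge_of_tendsto' ht fun n => hμ.abs_integral_spinProd_sub_le h2.le h4.le hν n A
  rw [mul_zero] at this
  exact sub_eq_zero.1 (abs_eq_zero.1 (le_antisymm this (abs_nonneg _)))

theorem IsCriticalInverseTemperature.pos {βc : ℝ} (h : IsCriticalInverseTemperature βc) :
    0 < βc := by
  obtain ⟨δ, hδ, hu⟩ := exists_pos_isGibbs_unique
  refine hδ.trans_le (h.2 ?_)
  rintro β ⟨h0, μ, ν, hμ, hν, hne⟩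
  by_contra hlt
  exact hne (hu β h0 (not_le.1 hlt) μ ν hμ hν)

/-! ### Finite-volume systems -/

/-- The weight of a bond in the joint distribution of spins and bonds. -/
def bondFactor (β : ℝ) (agree isOpen : Bool) : ℝ :=
  if isOpen then (if agree then Real.exp β - Real.exp (-β) else 0) else Real.exp (-β)

theorem bondFactor_nonneg {β : ℝ} (hβ : 0 ≤ β) (a o : Bool) : 0 ≤ bondFactor β a o := by
  have : Real.exp (-β) ≤ Real.exp β := Real.exp_le_exp.2 (by linarith)
  unfold bondFactor
  split_ifs
  · linarith
  · exact le_rfl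
  · positivity

/-- The bond weight as a function of the spin and bond configurations. -/
def bondWeight (β : ℝ) (σ : SpinConfig) (n : BondConfig) (b : Bond) : ℝ :=
  bondFactor β (decide (σ (Bond.src b) = σ (Bond.tgt b))) (n b)

/-- A closed bond has weight `exp (-β)` whether or not its end spins agree, so given the bonds the
spins are tied together only along open bonds. -/
theorem jointWeight_eq (β : ℝ) (V : Finset Site) (σ : SpinConfig) (n : BondConfig) :
    jointWeight β V σ n = ∏ b ∈ bondsIn V, bondWeight β σ n b := by
  rw [jointWeight, energy, mul_neg, neg_mul, neg_neg, Finset.mul_sum, Real.exp_sum,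
    ← Finset.prod_mul_distrib]
  refine Finset.prod_congr rfl fun b _ => ?_
  have e : Real.exp β * Real.exp (-2 * β) = Real.exp (-β) := by
    rw [← Real.exp_add]; congr 1; ring
  unfold bondWeight bondProb bondFactor spin
  rcases σ (Bond.src b) <;> rcases σ (Bond.tgt b) <;> rcases n b <;> simp [mul_sub, ← e]

theorem jointWeight_nonneg {β : ℝ} (hβ : 0 ≤ β) (V : Finset Site) (σ : SpinConfig)
    (n : BondConfig) : 0 ≤ jointWeight β V σ n := by
  rw [jointWeight_eq]
  exact Finset.prod_nonneg fun b _ => bondFactor_nonneg hβ _ _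

/-- The extension of a spin configuration in `V` to the whole lattice. -/
abbrev extendSpin (V : Finset Site) (s : V → Bool) : SpinConfig := glue V s fun _ => true

/-- The extension of a bond configuration in `V` to the whole lattice. -/
abbrev extendBond (V : Finset Site) (n : bondsIn V → Bool) : BondConfig :=
  glue (bondsIn V) n fun _ => false

/-- Weighted sum of an observable over the configurations in `V`. -/
def weightedSum (β : ℝ) (V : Finset Site) (F : SpinConfig → BondConfig → ℝ) : ℝ :=
  ∑ s : V → Bool, ∑ n : bondsIn V → Bool,
    jointWeight β V (extendSpin V s) (extendBond V n) * F (extendSpin V s) (extendBond V n)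

/-- The partition function of the joint system. -/
def partitionSum (β : ℝ) (V : Finset Site) : ℝ := weightedSum β V fun _ _ => 1

theorem weightedSum_mono {β : ℝ} (hβ : 0 ≤ β) (V : Finset Site)
    {F G : SpinConfig → BondConfig → ℝ} (h : ∀ σ n, F σ n ≤ G σ n) :
    weightedSum β V F ≤ weightedSum β V G :=
  Finset.sum_le_sum fun _ _ => Finset.sum_le_sum fun _ _ =>
    mul_le_mul_of_nonneg_left (h _ _) (jointWeight_nonneg hβ _ _ _)

theorem partitionSum_pos {β : ℝ} (hβ : 0 ≤ β) (V : Finset Site) : 0 < partitionSum β V := by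
  refine Finset.sum_pos' (fun s _ => Finset.sum_nonneg fun n _ => ?_)
    ⟨fun _ => true, Finset.mem_univ _, ?_⟩
  · rw [mul_one]; exact jointWeight_nonneg hβ _ _ _
  refine Finset.sum_pos' (fun n _ => ?_) ⟨fun _ => false, Finset.mem_univ _, ?_⟩
  · rw [mul_one]; exact jointWeight_nonneg hβ _ _ _
  rw [mul_one, jointWeight_eq]
  refine Finset.prod_pos fun b hb => ?_
  have : extendBond V (fun _ => false) b = false := by simp [extendBond, glue]
  rw [bondWeight, this]
  simp [bondFactor, Real.exp_pos]

theorem toReal_finiteSystem_apply {β : ℝ} (hβ : 0 ≤ β) (V : Finset Site)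
    {T : Set (SpinConfig × BondConfig)} (hT : MeasurableSet T) :
    (finiteSystem β V T).toReal =
      weightedSum β V (fun σ n => T.indicator 1 (σ, n)) / partitionSum β V := by
  have hw := fun σ n => jointWeight_nonneg hβ V σ n
  have hZ : (∑ s : V → Bool, ∑ n : bondsIn V → Bool, ENNReal.ofReal (jointWeight β V
      (glue V s fun _ => true) (glue (bondsIn V) n fun _ => false))) =
      ENNReal.ofReal (partitionSum β V) := by
    rw [partitionSum, weightedSum, ENNReal.ofReal_sum_of_nonneg]
    · refine Finset.sum_congr rfl fun s _ => ?_
      rw [ENNReal.ofReal_sum_of_nonneg]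
      · simp
      · intro n _; rw [mul_one]; exact hw _ _
    · intro s _
      refine Finset.sum_nonneg fun n _ => ?_
      rw [mul_one]; exact hw _ _
  have hn : ∀ c, (0 : ℝ) ≤ T.indicator 1 c := fun c => Set.indicator_nonneg (by simp) _
  rw [finiteSystem, hZ]
  simp only [Measure.smul_apply, Measure.finsetSum_apply, Measure.dirac_apply' _ hT, smul_eq_mul]
  rw [ENNReal.toReal_mul, ENNReal.toReal_inv, ENNReal.toReal_ofReal (partitionSum_pos hβ V).le,
    inv_mul_eq_div, weightedSum, ENNReal.toReal_sum]
  · congr 1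
    refine Finset.sum_congr rfl fun s _ => ?_
    rw [ENNReal.toReal_sum]
    · refine Finset.sum_congr rfl fun n _ => ?_
      rw [ENNReal.toReal_mul, ENNReal.toReal_ofReal (hw _ _)]
      congr 1
      by_cases h : (extendSpin V s, extendBond V n) ∈ T
      · rw [Set.indicator_of_mem h, Set.indicator_of_mem h]; simp
      · rw [Set.indicator_of_notMem h, Set.indicator_of_notMem h]; simp
    · intro n _
      refine ENNReal.mul_ne_top ENNReal.ofReal_ne_top ?_
      exact ne_top_of_le_ne_top ENNReal.one_ne_top (Set.indicator_le_self' (by simp) _)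
  · intro s _
    refine ENNReal.sum_ne_top.2 fun n _ => ?_
    refine ENNReal.mul_ne_top ENNReal.ofReal_ne_top ?_
    exact ne_top_of_le_ne_top ENNReal.one_ne_top (Set.indicator_le_self' (by simp) _)

/-! ### Correlations and connections -/

theorem openGraph_adj {n : BondConfig} {x y : Site} (h : (openGraph n).Adj x y) :
    ∃ b, n b = true ∧
      ((Bond.src b = x ∧ Bond.tgt b = y) ∨ (Bond.src b = y ∧ Bond.tgt b = x)) := by
  rw [openGraph, SimpleGraph.fromRel_adj] at h
  rcases h.2 with ⟨b, hb, h1, h2⟩ | ⟨b, hb, h1, h2⟩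
  · exact ⟨b, hb, .inl ⟨h1, h2⟩⟩
  · exact ⟨b, hb, .inr ⟨h1, h2⟩⟩

theorem reachable_of_isOpen {n : BondConfig} {b : Bond} (h : n b = true) :
    (openGraph n).Reachable (Bond.src b) (Bond.tgt b) := by
  by_cases he : Bond.src b = Bond.tgt b
  · rw [he]
  · refine SimpleGraph.Adj.reachable ?_
    rw [openGraph, SimpleGraph.fromRel_adj]
    exact ⟨he, .inl ⟨b, h, rfl, rfl⟩⟩

theorem openGraph_mono {n m : BondConfig} (h : ∀ b, n b = true → m b = true) :
    openGraph n ≤ openGraph m := by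
  intro x y hxy
  rw [openGraph, SimpleGraph.fromRel_adj] at hxy ⊢
  refine ⟨hxy.1, hxy.2.imp ?_ ?_⟩
  · rintro ⟨b, hb, h'⟩; exact ⟨b, h b hb, h'⟩
  · rintro ⟨b, hb, h'⟩; exact ⟨b, h b hb, h'⟩

theorem eq_of_reachable {α : Type*} {n : BondConfig} {f : Site → α}
    (h : ∀ b, n b = true → f (Bond.src b) = f (Bond.tgt b)) {x y : Site}
    (hxy : (openGraph n).Reachable x y) : f x = f y := by
  rw [SimpleGraph.reachable_iff_reflTransGen] at hxy
  induction hxy with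
  | refl => rfl
  | tail _ hadj ih =>
    obtain ⟨b, hb, ⟨rfl, rfl⟩ | ⟨rfl, rfl⟩⟩ := openGraph_adj hadj
    · rw [ih, h b hb]
    · rw [ih, h b hb]

open Classical in
/-- The indicator of the event that `x` and `y` belong to the same cluster. -/
def connInd (x y : Site) (n : BondConfig) : ℝ := if (openGraph n).Reachable x y then 1 else 0

theorem connInd_nonneg (x y : Site) (n : BondConfig) : 0 ≤ connInd x y n := by
  unfold connInd; split_ifs <;> simp

/-- With the bonds fixed, spins are equal on each cluster wherever the weight is nonzero. If `y` is
not in the cluster of `x`, flipping that cluster preserves the weight and changes the sign of the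
product. -/
theorem sum_spin_eq_conn (β : ℝ) {V : Finset Site} {n : BondConfig}
    (hn : ∀ b, n b = true → b ∈ bondsIn V) {x y : Site} (hx : x ∈ V) (hy : y ∈ V) :
    ∑ s : V → Bool, jointWeight β V (extendSpin V s) n *
        (spin (extendSpin V s) x * spin (extendSpin V s) y) =
      connInd x y n * ∑ s : V → Bool, jointWeight β V (extendSpin V s) n := by
  by_cases h : (openGraph n).Reachable x y
  · rw [connInd, if_pos h, one_mul]
    refine Finset.sum_congr rfl fun s _ => ?_
    by_cases h0 : jointWeight β V (extendSpin V s) n = 0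
    · rw [h0, zero_mul]
    have hs : extendSpin V s x = extendSpin V s y := by
      refine eq_of_reachable (fun b hb => ?_) h
      by_contra hne
      refine h0 ?_
      rw [jointWeight_eq]
      refine Finset.prod_eq_zero (hn b hb) ?_
      simp [bondWeight, bondFactor, hb, hne]
    have : spin (extendSpin V s) x = spin (extendSpin V s) y := by rw [spin, spin, hs]
    rw [this, spin_mul_self, mul_one]
  · classical
    rw [connInd, if_neg h, zero_mul]
    set C : Set Site := {z | (openGraph n).Reachable x z}
    have hxC : x ∈ C := SimpleGraph.Reachable.refl x
    have hyC : y ∉ C := h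
    let flip : (V → Bool) → (V → Bool) := fun s v => if v.1 ∈ C then !s v else s v
    have hflip : Function.Involutive flip := by
      intro s; funext v; by_cases hv : v.1 ∈ C <;> simp [flip, hv]
    have hext : ∀ s z, z ∈ V → extendSpin V (flip s) z =
        if z ∈ C then !extendSpin V s z else extendSpin V s z := by
      intro s z hz; simp [extendSpin, glue, hz, flip]
    have hw : ∀ s, jointWeight β V (extendSpin V (flip s)) n =
        jointWeight β V (extendSpin V s) n := by
      intro s
      rw [jointWeight_eq, jointWeight_eq]
      refine Finset.prod_congr rfl fun b hb => ?_
      by_cases hnb : n b = true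
      · have hC : Bond.src b ∈ C ↔ Bond.tgt b ∈ C :=
          ⟨fun h' => SimpleGraph.Reachable.trans h' (reachable_of_isOpen hnb),
            fun h' => SimpleGraph.Reachable.trans h' (reachable_of_isOpen hnb).symm⟩
        rw [mem_bondsIn] at hb
        rw [bondWeight, bondWeight, hext _ _ hb.1, hext _ _ hb.2]
        by_cases h' : Bond.tgt b ∈ C <;> simp [hC, h']
      · simp [bondWeight, bondFactor, hnb]
    have hs := Equiv.sum_comp (Function.Involutive.toPerm flip hflip) fun s =>
      jointWeight β V (extendSpin V s) n * (spin (extendSpin V s) x * spin (extendSpin V s) y)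
    have hs' : ∀ s, jointWeight β V (extendSpin V (flip s)) n *
        (spin (extendSpin V (flip s)) x * spin (extendSpin V (flip s)) y) =
        -(jointWeight β V (extendSpin V s) n *
          (spin (extendSpin V s) x * spin (extendSpin V s) y)) := by
      intro s
      have e1 : spin (extendSpin V (flip s)) x = -spin (extendSpin V s) x := by
        rw [spin, spin, hext s x hx, if_pos hxC]
        rcases extendSpin V s x <;> simp
      have e2 : spin (extendSpin V (flip s)) y = spin (extendSpin V s) y := by
        rw [spin, spin, hext s y hy, if_neg hyC]
      rw [hw, e1, e2]; ring
    simp only [Function.Involutive.coe_toPerm, hs', Finset.sum_neg_distrib] at hs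
    linarith

theorem mem_bondsIn_of_extendBond {V : Finset Site} {n : bondsIn V → Bool} {b : Bond}
    (h : extendBond V n b = true) : b ∈ bondsIn V := by
  by_contra hb
  simp [extendBond, glue, hb] at h

/-- The weight of a bond configuration. -/
def clusterWeight (β : ℝ) (V : Finset Site) (n : BondConfig) : ℝ :=
  ∑ s : V → Bool, jointWeight β V (extendSpin V s) n

theorem clusterWeight_nonneg {β : ℝ} (hβ : 0 ≤ β) (V : Finset Site) (n : BondConfig) :
    0 ≤ clusterWeight β V n := Finset.sum_nonneg fun _ _ => jointWeight_nonneg hβ _ _ _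

theorem weightedSum_bond (β : ℝ) (V : Finset Site) (f : BondConfig → ℝ) :
    weightedSum β V (fun _ n => f n) =
      ∑ n : bondsIn V → Bool, clusterWeight β V (extendBond V n) * f (extendBond V n) := by
  rw [weightedSum, Finset.sum_comm]
  exact Finset.sum_congr rfl fun n _ => by rw [clusterWeight, Finset.sum_mul]

/-- The two-point function is the connection probability. -/
theorem weightedSum_spin_eq_conn (β : ℝ) {V : Finset Site} {x y : Site} (hx : x ∈ V)
    (hy : y ∈ V) :
    weightedSum β V (fun σ _ => spin σ x * spin σ y) =
      weightedSum β V (fun _ n => connInd x y n) := by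
  rw [weightedSum_bond, weightedSum, Finset.sum_comm]
  refine Finset.sum_congr rfl fun n _ => ?_
  rw [sum_spin_eq_conn β (fun _ => mem_bondsIn_of_extendBond) hx hy, mul_comm, clusterWeight]

/-! ### Insertion of a bond -/

/-- The cost of opening a closed bond. -/
def insertionConst (β : ℝ) : ℝ := min 1 ((Real.exp (2 * β) - 1) / 2)

theorem insertionConst_pos {β : ℝ} (hβ : 0 < β) : 0 < insertionConst β := by
  refine lt_min one_pos ?_
  have : 1 < Real.exp (2 * β) := Real.one_lt_exp_iff.2 (by linarith)
  linarith

/-- Opening a closed bond multiplies the joint weight by `exp (2β) - 1` times the indicator `(1 + S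
S') / 2` that its end spins agree. Summing over spins turns `S S'` into a connection indicator,
which is nonnegative. The minimum with 1 covers a bond already open. -/
theorem clusterWeight_update {β : ℝ} (hβ : 0 ≤ β) {V : Finset Site} {n : BondConfig}
    (hn : ∀ b, n b = true → b ∈ bondsIn V) {b : Bond} (hb : b ∈ bondsIn V) :
    insertionConst β * clusterWeight β V n ≤ clusterWeight β V (Function.update n b true) := by
  have hc0 := clusterWeight_nonneg hβ V n
  by_cases hnb : n b = true
  · rw [← hnb, Function.update_eq_self]
    exact mul_le_of_le_one_left hc0 (min_le_left _ _)
  have hw : ∀ σ, jointWeight β V σ (Function.update n b true) =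
      (Real.exp (2 * β) - 1) / 2 * (jointWeight β V σ n +
        jointWeight β V σ n * (spin σ (Bond.src b) * spin σ (Bond.tgt b))) := by
    intro σ
    rw [jointWeight_eq, jointWeight_eq, ← Finset.mul_prod_erase _ _ hb,
      ← Finset.mul_prod_erase _ (bondWeight β σ n) hb]
    have e : ∏ b' ∈ (bondsIn V).erase b, bondWeight β σ (Function.update n b true) b' =
        ∏ b' ∈ (bondsIn V).erase b, bondWeight β σ n b' := by
      refine Finset.prod_congr rfl fun b' hb' => ?_
      rw [bondWeight, bondWeight, Function.update_of_ne (Finset.ne_of_mem_erase hb')]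
    have e2 : Real.exp (2 * β) * Real.exp (-β) = Real.exp β := by
      rw [← Real.exp_add]; congr 1; ring
    rw [e, bondWeight, bondWeight, Function.update_self, Bool.eq_false_iff.2 hnb]
    by_cases ha : σ (Bond.src b) = σ (Bond.tgt b)
    · have : spin σ (Bond.src b) = spin σ (Bond.tgt b) := by rw [spin, spin, ha]
      rw [this, spin_mul_self]
      simp [bondFactor, ha, ← e2]; ring
    · have : spin σ (Bond.src b) * spin σ (Bond.tgt b) = -1 := by
        unfold spin
        rcases h1 : σ (Bond.src b) <;> rcases h2 : σ (Bond.tgt b) <;> simp_all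
      rw [this]
      simp [bondFactor, ha]
  have hmem := mem_bondsIn.1 hb
  rw [clusterWeight, clusterWeight, Finset.sum_congr rfl fun s _ => hw (extendSpin V s),
    ← Finset.mul_sum, Finset.sum_add_distrib, sum_spin_eq_conn β hn hmem.1 hmem.2,
    ← clusterWeight]
  have h1 : 1 ≤ Real.exp (2 * β) := Real.one_le_exp (by linarith)
  have h2 := mul_nonneg (connInd_nonneg (Bond.src b) (Bond.tgt b) n) hc0
  calc _ ≤ (Real.exp (2 * β) - 1) / 2 * clusterWeight β V n :=
        mul_le_mul_of_nonneg_right (min_le_right _ _) hc0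
    _ ≤ _ := mul_le_mul_of_nonneg_left (by linarith) (by linarith)

/-- Opening `b` extends a connection from its source to its target. The factor 2 appears because the
map opening `b` is two-to-one. -/
theorem weightedSum_conn_le {β : ℝ} (hβ : 0 ≤ β) {V : Finset Site} {b : Bond}
    (hb : b ∈ bondsIn V) (x : Site) :
    insertionConst β * weightedSum β V (fun _ n => connInd x (Bond.src b) n) ≤
      2 * weightedSum β V (fun _ n => connInd x (Bond.tgt b) n) := by
  rw [weightedSum_bond, weightedSum_bond, Finset.mul_sum]
  set g : (bondsIn V → Bool) → ℝ := fun n =>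
    clusterWeight β V (extendBond V n) * connInd x (Bond.tgt b) (extendBond V n) with hg
  have hg0 : ∀ n, 0 ≤ g n := fun n =>
    mul_nonneg (clusterWeight_nonneg hβ _ _) (connInd_nonneg _ _ _)
  let flip : (bondsIn V → Bool) → (bondsIn V → Bool) := fun n =>
    Function.update n ⟨b, hb⟩ (!n ⟨b, hb⟩)
  have hflip : Function.Involutive flip := by
    intro n; simp [flip]
  have hsum : ∑ n, g (flip n) = ∑ n, g n :=
    Equiv.sum_comp (Function.Involutive.toPerm flip hflip) g
  have hup : ∀ n, g (Function.update n ⟨b, hb⟩ true) ≤ g n + g (flip n) := by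
    intro n
    by_cases h : n ⟨b, hb⟩ = true
    · have : Function.update n ⟨b, hb⟩ true = n := by rw [← h, Function.update_eq_self]
      rw [this]; linarith [hg0 (flip n)]
    · have : Function.update n ⟨b, hb⟩ true = flip n := by simp [flip, h]
      rw [this]; linarith [hg0 n]
  have hext : ∀ n, extendBond V (Function.update n ⟨b, hb⟩ true) =
      Function.update (extendBond V n) b true := by
    intro n; funext b'
    by_cases h : b' = b
    · subst h; simp [extendBond, glue, hb]
    · by_cases h' : b' ∈ bondsIn V <;> simp [extendBond, glue, h, h', Function.update_of_ne]
  have key : ∀ n : bondsIn V → Bool, insertionConst β * (clusterWeight β V (extendBond V n) *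
      connInd x (Bond.src b) (extendBond V n)) ≤ g (Function.update n ⟨b, hb⟩ true) := by
    intro n
    have h1 := clusterWeight_update hβ (n := extendBond V n)
      (fun _ => mem_bondsIn_of_extendBond) hb
    have h2 : connInd x (Bond.src b) (extendBond V n) ≤
        connInd x (Bond.tgt b) (Function.update (extendBond V n) b true) := by
      by_cases h : (openGraph (extendBond V n)).Reachable x (Bond.src b)
      · have h3 : (openGraph (Function.update (extendBond V n) b true)).Reachable x
            (Bond.tgt b) := by
          refine (h.mono (openGraph_mono fun b' hb' => ?_)).trans
            (reachable_of_isOpen (by simp))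
          by_cases hbb : b' = b
          · subst hbb; simp
          · rw [Function.update_of_ne hbb, hb']
        rw [connInd, connInd, if_pos h, if_pos h3]
      · rw [connInd, if_neg h]; exact connInd_nonneg _ _ _
    simp only [hg, hext]
    rw [← mul_assoc]
    exact mul_le_mul h1 h2 (connInd_nonneg _ _ _) (clusterWeight_nonneg hβ _ _)
  calc _ ≤ ∑ n, (g n + g (flip n)) := Finset.sum_le_sum fun n _ => (key n).trans (hup n)
    _ = _ := by rw [Finset.sum_add_distrib, hsum, two_mul]

/-- The finite-volume two-point function. -/
def corr (β : ℝ) (V : Finset Site) (x y : Site) : ℝ :=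
  weightedSum β V (fun σ _ => spin σ x * spin σ y) / partitionSum β V

theorem corr_insertion {β : ℝ} (hβ : 0 ≤ β) {V : Finset Site} {b : Bond} {x : Site} (hx : x ∈ V)
    (hs : Bond.src b ∈ V) (ht : Bond.tgt b ∈ V) :
    insertionConst β / 2 * corr β V x (Bond.src b) ≤ corr β V x (Bond.tgt b) := by
  have h := weightedSum_conn_le hβ (mem_bondsIn.2 ⟨hs, ht⟩) x
  rw [corr, corr, ← mul_div_assoc, weightedSum_spin_eq_conn β hx hs,
    weightedSum_spin_eq_conn β hx ht]
  refine div_le_div_of_nonneg_right ?_ (partitionSum_pos hβ V).le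
  linarith

/-! ### Translation invariance -/

theorem sum_glue_map {α γ : Type} [DecidableEq α] [DecidableEq γ] (e : α ≃ γ) (U : Finset α)
    {W : Finset γ} (hW : W = U.map e.toEmbedding) (c : Bool) (F : (α → Bool) → ℝ) :
    ∑ t : W → Bool, F (fun a => glue W t (fun _ => c) (e a)) =
      ∑ s : U → Bool, F (glue U s fun _ => c) := by
  subst hW
  refine (Fintype.sum_equiv (Equiv.arrowCongr (e.subtypeEquiv fun a => by simp :
    U ≃ (U.map e.toEmbedding : Finset γ)) (Equiv.refl Bool)) _ _ fun s => ?_).symm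
  congr 1
  funext a
  by_cases ha : a ∈ U
  · have h2 : e a ∈ U.map e.toEmbedding := Finset.mem_map_of_mem e.toEmbedding ha
    rw [glue, glue, dif_pos ha, dif_pos h2]
    simp only [Equiv.arrowCongr_apply, Equiv.coe_refl, Function.comp_apply, id_eq]
    congr 1
    rw [Equiv.eq_symm_apply]
    rfl
  · have h2 : e a ∉ U.map e.toEmbedding := by simpa using ha
    rw [glue, glue, dif_neg ha, dif_neg h2]

/-- Translation of bonds. -/
def shiftBond (z : Site) : Bond ≃ Bond := (Equiv.addRight z).prodCongr (Equiv.refl _)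

theorem src_shiftBond (z : Site) (b : Bond) : Bond.src (shiftBond z b) = Bond.src b + z := rfl

theorem tgt_shiftBond (z : Site) (b : Bond) : Bond.tgt (shiftBond z b) = Bond.tgt b + z := by
  simp [shiftBond, Bond.tgt, add_right_comm]

/-- Translation of finite sets of sites. -/
def shiftSet (z : Site) (V : Finset Site) : Finset Site := V.map (Equiv.addRight z).toEmbedding

theorem mem_shiftSet {z : Site} {V : Finset Site} {x : Site} : x + z ∈ shiftSet z V ↔ x ∈ V := by
  simp [shiftSet]

theorem bondsIn_shiftSet (z : Site) (V : Finset Site) :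
    bondsIn (shiftSet z V) = (bondsIn V).map (shiftBond z).toEmbedding := by
  ext b
  obtain ⟨b, rfl⟩ := (shiftBond z).surjective b
  rw [mem_bondsIn, src_shiftBond, tgt_shiftBond, mem_shiftSet, mem_shiftSet, ← mem_bondsIn]
  simp

theorem weightedSum_shiftSet (β : ℝ) (z : Site) (V : Finset Site)
    (F : SpinConfig → BondConfig → ℝ) :
    weightedSum β (shiftSet z V) (fun σ n => F (fun x => σ (x + z)) fun b => n (shiftBond z b)) =
      weightedSum β V F := by
  have hw : ∀ σ n, jointWeight β (shiftSet z V) σ n =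
      jointWeight β V (fun x => σ (x + z)) fun b => n (shiftBond z b) := by
    intro σ n
    rw [jointWeight_eq, jointWeight_eq, bondsIn_shiftSet, Finset.prod_map]
    refine Finset.prod_congr rfl fun b _ => ?_
    simp [bondWeight, src_shiftBond, tgt_shiftBond]
  simp only [weightedSum, hw]
  refine Eq.trans ?_ (sum_glue_map (Equiv.addRight z) V (W := shiftSet z V) rfl true fun σ =>
    ∑ n : bondsIn V → Bool, jointWeight β V σ (extendBond V n) * F σ (extendBond V n))
  refine Finset.sum_congr rfl fun s _ => ?_
  exact sum_glue_map (shiftBond z) (bondsIn V) (bondsIn_shiftSet z V) false fun n =>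
    jointWeight β V (fun x => extendSpin (shiftSet z V) s (x + z)) n *
      F (fun x => extendSpin (shiftSet z V) s (x + z)) n

theorem corr_shiftSet (β : ℝ) (z : Site) (V : Finset Site) (x y : Site) :
    corr β (shiftSet z V) (x + z) (y + z) = corr β V x y := by
  rw [corr, corr, partitionSum, partitionSum]
  exact congrArg₂ (· / ·)
    (weightedSum_shiftSet β z V fun σ _ => spin σ x * spin σ y)
    (weightedSum_shiftSet β z V fun _ _ => 1)

theorem tendsto_shiftSet (z : Site) : Tendsto (shiftSet z) atTop atTop := by
  refine tendsto_atTop_finset_of_monotone (fun V W h => Finset.map_subset_map.2 h) fun x => ?_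
  exact ⟨{x - z}, by simp [shiftSet]⟩

/-! ### The infinite-volume system -/

/-- The event that the configuration agrees with `σ` on `A` and with `n` on `B`. -/
def cylinderEvent (A : Finset Site) (B : Finset Bond) (σ : SpinConfig) (n : BondConfig) :
    Set (SpinConfig × BondConfig) :=
  {c | (∀ x ∈ A, c.1 x = σ x) ∧ ∀ b ∈ B, c.2 b = n b}

theorem measurableSet_cylinderEvent (A : Finset Site) (B : Finset Bond) (σ : SpinConfig)
    (n : BondConfig) : MeasurableSet (cylinderEvent A B σ n) := by
  have : cylinderEvent A B σ n =
      (⋂ x ∈ A, {c | c.1 x = σ x}) ∩ ⋂ b ∈ B, {c | c.2 b = n b} := by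
    ext c; simp [cylinderEvent]
  rw [this]
  refine (A.measurableSet_biInter fun x _ => ?_).inter (B.measurableSet_biInter fun b _ => ?_)
  · exact ((measurable_pi_apply (X := fun _ : Site => Bool) x).comp measurable_fst)
      (measurableSet_singleton _)
  · exact ((measurable_pi_apply (X := fun _ : Bond => Bool) b).comp measurable_snd)
      (measurableSet_singleton _)

/-- The event `T` depends only on the spins in `A` and the bonds in `B`. -/
def IsLocal (A : Finset Site) (B : Finset Bond) (T : Set (SpinConfig × BondConfig)) : Prop :=
  ∀ c c' : SpinConfig × BondConfig, (∀ x ∈ A, c.1 x = c'.1 x) → (∀ b ∈ B, c.2 b = c'.2 b) →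
    c ∈ T → c' ∈ T

open Classical in
/-- The configurations on `A` and `B` compatible with the event `T`. -/
def localPatterns (A : Finset Site) (B : Finset Bond) (T : Set (SpinConfig × BondConfig)) :
    Finset ((A → Bool) × (B → Bool)) :=
  Finset.univ.filter fun p => (glue A p.1 fun _ => true, glue B p.2 fun _ => true) ∈ T

theorem IsLocal.eq_biUnion {A : Finset Site} {B : Finset Bond}
    {T : Set (SpinConfig × BondConfig)} (hT : IsLocal A B T) :
    T = ⋃ p ∈ localPatterns A B T,
      cylinderEvent A B (glue A p.1 fun _ => true) (glue B p.2 fun _ => true) := by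
  ext c
  simp only [Set.mem_iUnion, localPatterns, Finset.mem_filter, Finset.mem_univ, true_and]
  constructor
  · intro hc
    refine ⟨(fun x => c.1 x, fun b => c.2 b), hT c _ ?_ ?_ hc, ?_, ?_⟩
    all_goals intro x hx; simp [glue, hx]
  · rintro ⟨p, hp, h1, h2⟩
    exact hT _ c (fun x hx => (h1 x hx).symm) (fun b hb => (h2 b hb).symm) hp

theorem IsLocal.measurableSet {A : Finset Site} {B : Finset Bond}
    {T : Set (SpinConfig × BondConfig)} (hT : IsLocal A B T) : MeasurableSet T := by
  rw [hT.eq_biUnion]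
  exact Finset.measurableSet_biUnion _ fun p _ => measurableSet_cylinderEvent _ _ _ _

theorem IsLocal.measure_eq {A : Finset Site} {B : Finset Bond}
    {T : Set (SpinConfig × BondConfig)} (hT : IsLocal A B T)
    (Q : Measure (SpinConfig × BondConfig)) :
    Q T = ∑ p ∈ localPatterns A B T,
      Q (cylinderEvent A B (glue A p.1 fun _ => true) (glue B p.2 fun _ => true)) := by
  conv_lhs => rw [hT.eq_biUnion]
  refine measure_biUnion_finset ?_ fun p _ => measurableSet_cylinderEvent _ _ _ _
  intro p _ p' _ hne
  refine Set.disjoint_left.2 fun c hc hc' => hne ?_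
  ext x
  · have h1 := hc.1 x x.2
    rw [hc'.1 x x.2] at h1
    simpa [glue, eq_comm] using h1
  · have h1 := hc.2 x x.2
    rw [hc'.2 x x.2] at h1
    simpa [glue, eq_comm] using h1

section

variable {β : ℝ} {P : Measure (SpinConfig × BondConfig)}

/-- A local event is a finite disjoint union of cylinders, for which convergence is the definition.
-/
theorem IsInfiniteSystem.tendsto_local (hP : IsInfiniteSystem β P) {A : Finset Site}
    {B : Finset Bond} {T : Set (SpinConfig × BondConfig)} (hT : IsLocal A B T) :
    Tendsto (fun V => (finiteSystem β V T).toReal) atTop (𝓝 (P T).toReal) := by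
  have := hP.1
  refine (ENNReal.tendsto_toReal (measure_ne_top P T)).comp ?_
  simp_rw [hT.measure_eq]
  exact tendsto_finsetSum _ fun p _ => hP.2 A B _ _

/-- The event that two spins agree. -/
def agreeEvent (x y : Site) : Set (SpinConfig × BondConfig) := {c | c.1 x = c.1 y}

theorem isLocal_agreeEvent (x y : Site) : IsLocal {x, y} ∅ (agreeEvent x y) := by
  intro c c' h _ hc
  have h1 := h x (by simp)
  have h2 := h y (by simp)
  simp only [agreeEvent, Set.mem_ofPred_eq] at *
  rw [← h1, ← h2, hc]

theorem isLocal_compl_agreeEvent (x y : Site) : IsLocal {x, y} ∅ (agreeEvent x y)ᶜ := by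
  intro c c' h h' hc hc'
  exact hc (isLocal_agreeEvent x y c' c (fun z hz => (h z hz).symm) (fun b hb => (h' b hb).symm) hc')

theorem spin_mul_eq_indicator (x y : Site) (c : SpinConfig × BondConfig) :
    spin c.1 x * spin c.1 y =
      (agreeEvent x y).indicator 1 c - (agreeEvent x y)ᶜ.indicator 1 c := by
  by_cases h : c ∈ agreeEvent x y
  · rw [Set.indicator_of_mem h, Set.indicator_of_notMem (by simpa using h)]
    have : spin c.1 x = spin c.1 y := by rw [spin, spin, show c.1 x = c.1 y from h]
    rw [this, spin_mul_self]; simp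
  · rw [Set.indicator_of_notMem h, Set.indicator_of_mem (by simpa using h)]
    have : c.1 x ≠ c.1 y := h
    unfold spin
    rcases h1 : c.1 x <;> rcases h2 : c.1 y <;> simp_all

theorem corr_eq_sub (hβ : 0 ≤ β) (V : Finset Site) (x y : Site) :
    corr β V x y = (finiteSystem β V (agreeEvent x y)).toReal -
      (finiteSystem β V (agreeEvent x y)ᶜ).toReal := by
  rw [toReal_finiteSystem_apply hβ V (isLocal_agreeEvent x y).measurableSet,
    toReal_finiteSystem_apply hβ V (isLocal_compl_agreeEvent x y).measurableSet, ← sub_div, corr]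
  congr 1
  simp only [weightedSum, ← Finset.sum_sub_distrib, ← mul_sub]
  refine Finset.sum_congr rfl fun s _ => Finset.sum_congr rfl fun n _ => ?_
  rw [← spin_mul_eq_indicator]

/-- The infinite-volume correlation of two spins. -/
def corrInf (P : Measure (SpinConfig × BondConfig)) (x y : Site) : ℝ :=
  ∫ c, spin c.1 x * spin c.1 y ∂P

theorem IsInfiniteSystem.tendsto_corr (hP : IsInfiniteSystem β P) (hβ : 0 ≤ β) (x y : Site) :
    Tendsto (fun V => corr β V x y) atTop (𝓝 (corrInf P x y)) := by
  have := hP.1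
  have hm := (isLocal_agreeEvent x y).measurableSet
  have e : corrInf P x y = (P (agreeEvent x y)).toReal - (P (agreeEvent x y)ᶜ).toReal := by
    simp_rw [corrInf, spin_mul_eq_indicator]
    rw [integral_sub, integral_indicator_one hm, integral_indicator_one hm.compl]
    · rfl
    · exact (integrable_const (1 : ℝ)).indicator hm
    · exact (integrable_const (1 : ℝ)).indicator hm.compl
  rw [e]
  simp_rw [corr_eq_sub hβ]
  exact (hP.tendsto_local (isLocal_agreeEvent x y)).sub
    (hP.tendsto_local (isLocal_compl_agreeEvent x y))

/-- The limit runs over all finite volumes, and shifted volumes also exhaust the lattice. -/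
theorem IsInfiniteSystem.corrInf_add (hP : IsInfiniteSystem β P) (hβ : 0 ≤ β) (x y z : Site) :
    corrInf P (x + z) (y + z) = corrInf P x y := by
  have h := (hP.tendsto_corr hβ (x + z) (y + z)).comp (tendsto_shiftSet z)
  simp only [Function.comp_def, corr_shiftSet] at h
  exact tendsto_nhds_unique h (hP.tendsto_corr hβ x y)

theorem IsInfiniteSystem.corrInf_eq_twoPoint (hP : IsInfiniteSystem β P) (hβ : 0 ≤ β)
    (x y : Site) : corrInf P x y = twoPoint P (y - x) := by
  have := hP.corrInf_add hβ 0 (y - x) x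
  rwa [zero_add, sub_add_cancel] at this

theorem twoPoint_zero [IsProbabilityMeasure P] : twoPoint P 0 = 1 := by
  simp [twoPoint, spin_mul_self]

/-- Each step along the axis costs a positive factor independent of the volume, which therefore
survives the limit. -/
theorem IsInfiniteSystem.twoPoint_pos (hP : IsInfiniteSystem β P) (hβ : 0 < β) (k : ℕ) :
    0 < twoPoint P (k, 0) := by
  have := hP.1
  induction k with
  | zero => simpa using (twoPoint_zero (P := P)).symm ▸ one_pos
  | succ k ih =>
    let b : Bond := ((k, 0), 0)
    have h1 : Bond.src b = ((k : ℤ), (0 : ℤ)) := rfl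
    have h2 : Bond.tgt b = (((k + 1 : ℕ) : ℤ), (0 : ℤ)) := by simp [Bond.tgt, b]
    have h : insertionConst β / 2 * corrInf P 0 (Bond.src b) ≤ corrInf P 0 (Bond.tgt b) := by
      refine le_of_tendsto_of_tendsto ((hP.tendsto_corr hβ.le _ _).const_mul _)
        (hP.tendsto_corr hβ.le _ _) ?_
      filter_upwards [eventually_ge_atTop {0, Bond.src b, Bond.tgt b}] with V hV
      exact corr_insertion hβ.le (hV (by simp)) (hV (by simp)) (hV (by simp))
    rw [h1, h2] at h
    exact (mul_pos (half_pos (insertionConst_pos hβ)) ih).trans_le h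

/-! ### Connection probabilities in infinite volume -/

/-- The bond configuration with the bonds off `B` closed. -/
def restrictBonds (B : Finset Bond) (n : BondConfig) : BondConfig := fun b => decide (b ∈ B) && n b

/-- The event that `x` and `y` are connected by open bonds in `B`. -/
def connIn (B : Finset Bond) (x y : Site) : Set (SpinConfig × BondConfig) :=
  {c | (openGraph (restrictBonds B c.2)).Reachable x y}

/-- The event that `x` and `y` belong to the same cluster. -/
def connEvent (x y : Site) : Set (SpinConfig × BondConfig) := {c | (openGraph c.2).Reachable x y}

theorem isLocal_connIn (B : Finset Bond) (x y : Site) : IsLocal ∅ B (connIn B x y) := by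
  intro c c' _ h hc
  have : restrictBonds B c'.2 = restrictBonds B c.2 := by
    funext b
    by_cases hb : b ∈ B <;> simp [restrictBonds, hb, h b]
  simp only [connIn, Set.mem_ofPred_eq] at *
  rwa [this]

theorem connIn_mono (x y : Site) : Monotone fun B => connIn B x y := by
  intro B B' h c hc
  refine SimpleGraph.Reachable.mono (openGraph_mono fun b hb => ?_) hc
  simp only [restrictBonds, Bool.and_eq_true, decide_eq_true_eq] at hb ⊢
  exact ⟨h hb.1, hb.2⟩

theorem connIn_subset (B : Finset Bond) (x y : Site) : connIn B x y ⊆ connEvent x y := by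
  intro c hc
  refine SimpleGraph.Reachable.mono (openGraph_mono fun b hb => ?_) hc
  simp only [restrictBonds, Bool.and_eq_true, decide_eq_true_eq] at hb
  exact hb.2

theorem iUnion_connIn (x y : Site) : ⋃ B, connIn B x y = connEvent x y := by
  refine (Set.iUnion_subset fun B => connIn_subset B x y).antisymm fun c hc => ?_
  rw [connEvent, Set.mem_ofPred_eq, SimpleGraph.reachable_iff_reflTransGen] at hc
  induction hc with
  | refl => exact Set.mem_iUnion.2 ⟨∅, SimpleGraph.Reachable.refl x⟩
  | tail _ hadj ih =>
    obtain ⟨B, hB⟩ := Set.mem_iUnion.1 ih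
    obtain ⟨b, hb, hb'⟩ := openGraph_adj hadj
    refine Set.mem_iUnion.2 ⟨insert b B, ?_⟩
    have h1 := connIn_mono _ _ (Finset.subset_insert b B) hB
    have h2 : (openGraph (restrictBonds (insert b B) c.2)).Reachable (Bond.src b) (Bond.tgt b) :=
      reachable_of_isOpen (by simp [restrictBonds, hb])
    rcases hb' with ⟨rfl, rfl⟩ | ⟨rfl, rfl⟩
    · exact SimpleGraph.Reachable.trans h1 h2
    · exact SimpleGraph.Reachable.trans h1 h2.symm

theorem measurableSet_connEvent (x y : Site) : MeasurableSet (connEvent x y) := by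
  rw [← iUnion_connIn]
  exact MeasurableSet.iUnion fun B => (isLocal_connIn B x y).measurableSet

/-- Connection inside a finite `B` is local, so its probability passes to the limit; in each large
volume it is at most the full connection probability, which is the spin correlation. -/
theorem IsInfiniteSystem.toReal_connIn_le (hP : IsInfiniteSystem β P) (hβ : 0 ≤ β)
    (B : Finset Bond) (x y : Site) : (P (connIn B x y)).toReal ≤ corrInf P x y := by
  refine le_of_tendsto_of_tendsto (hP.tendsto_local (isLocal_connIn B x y))
    (hP.tendsto_corr hβ x y) ?_
  filter_upwards [eventually_ge_atTop {x, y}] with V hV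
  rw [toReal_finiteSystem_apply hβ V (isLocal_connIn B x y).measurableSet, corr,
    weightedSum_spin_eq_conn β (hV (by simp)) (hV (by simp))]
  refine div_le_div_of_nonneg_right (weightedSum_mono hβ V fun σ n => ?_) (partitionSum_pos hβ V).le
  by_cases h : (σ, n) ∈ connIn B x y
  · have h' : (openGraph n).Reachable x y := connIn_subset B x y h
    rw [Set.indicator_of_mem h, connInd, if_pos h']; simp
  · rw [Set.indicator_of_notMem h]; exact connInd_nonneg _ _ _

theorem IsInfiniteSystem.twoPoint_nonneg (hP : IsInfiniteSystem β P) (hβ : 0 ≤ β) (x : Site) :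
    0 ≤ twoPoint P x :=
  ENNReal.toReal_nonneg.trans (hP.toReal_connIn_le hβ ∅ 0 x)

/-- The connection probability is at most the two-point function. -/
theorem IsInfiniteSystem.measure_connEvent_le (hP : IsInfiniteSystem β P) (hβ : 0 ≤ β)
    (x y : Site) : P (connEvent x y) ≤ ENNReal.ofReal (twoPoint P (y - x)) := by
  have := hP.1
  rw [← iUnion_connIn, (connIn_mono x y).measure_iUnion, ← hP.corrInf_eq_twoPoint hβ]
  refine iSup_le fun B => ?_
  rw [← ENNReal.ofReal_toReal (measure_ne_top P (connIn B x y))]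
  exact ENNReal.ofReal_le_ofReal (hP.toReal_connIn_le hβ B x y)

end

/-! ### Small clusters -/

/-- The rescaled sites `a x` and `a y` are at distance at most `ε`. -/
def IsClose (a ε : ℝ) (x y : Site) : Prop := dist (a • toPlane x) (a • toPlane y) ≤ ε

theorem mem_box_iff {a : ℝ} (ha : 0 < a) {x : Site} :
    x ∈ box (1 / a) ↔ ∀ i, (a • toPlane x) i ∈ Set.Icc (0 : ℝ) 1 := by
  simp only [box, Finset.mem_product, Finset.mem_Icc, Int.le_floor, le_div_iff₀ ha, Fin.forall_fin_two,
    toPlane, PiLp.smul_apply, smul_eq_mul, Set.mem_Icc, mul_nonneg_iff_of_pos_left ha]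
  simp [mul_comm]

theorem sub_mem_square_of_isClose {a ε : ℝ} (ha : 0 < a) {x y : Site} (h : IsClose a ε x y) :
    y - x ∈ square ⌊ε / a⌋₊ := by
  have h1 : ‖toPlane (y - x)‖ ≤ ε / a := by
    have e : toPlane (y - x) = toPlane y - toPlane x := by
      ext i; fin_cases i <;> simp [toPlane]
    rw [IsClose, dist_comm, dist_eq_norm, ← smul_sub, norm_smul, Real.norm_of_nonneg ha.le] at h
    rw [e, le_div_iff₀ ha, mul_comm]
    exact h
  have key : ∀ u : ℤ, |(u : ℝ)| ≤ ε / a → -(⌊ε / a⌋₊ : ℤ) ≤ u ∧ u ≤ ⌊ε / a⌋₊ := by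
    intro u hu
    rw [← abs_le, Int.abs_eq_natAbs]
    have : u.natAbs ≤ ⌊ε / a⌋₊ := Nat.le_floor (by rwa [Nat.cast_natAbs, Int.cast_abs])
    exact_mod_cast this
  exact mem_square.2 ⟨key _ ((abs_fst_le_norm _).trans h1), key _ ((abs_snd_le_norm _).trans h1)⟩

open Classical in
theorem sq_ncard_restrictedCluster_le {a ε : ℝ} (ha : 0 < a) (C : Set Site)
    (h : Metric.diam (restrictedCluster a C) ≤ ε) :
    ((restrictedCluster a C).ncard : ℝ≥0∞) ^ 2 ≤
      ∑ x ∈ box (1 / a), ∑ y ∈ box (1 / a) with IsClose a ε x y,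
        if x ∈ C ∧ y ∈ C then 1 else 0 := by
  set F := (box (1 / a)).filter (· ∈ C) with hF
  have hR : restrictedCluster a C = (fun x : Site => a • toPlane x) '' F := by
    ext z
    constructor
    · rintro ⟨⟨x, hx, rfl⟩, hz⟩
      exact ⟨x, Finset.mem_coe.2 (Finset.mem_filter.2 ⟨(mem_box_iff ha).2 hz, hx⟩), rfl⟩
    · rintro ⟨x, hx, rfl⟩
      have hx := Finset.mem_filter.1 (Finset.mem_coe.1 hx)
      exact ⟨⟨x, hx.2, rfl⟩, (mem_box_iff ha).1 hx.1⟩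
  -- Finiteness matters because `Metric.diam` of an unbounded set is 0 by default.
  have hfin : (restrictedCluster a C).Finite := hR ▸ F.finite_toSet.image _
  have hclose : ∀ x ∈ F, ∀ y ∈ F, IsClose a ε x y := fun x hx y hy =>
    (Metric.dist_le_diam_of_mem hfin.isBounded (hR ▸ Set.mem_image_of_mem _ hx)
      (hR ▸ Set.mem_image_of_mem _ hy)).trans h
  have hcard : (restrictedCluster a C).ncard ≤ F.card := by
    rw [hR, ← Set.ncard_coe_finset F]
    exact Set.ncard_image_le F.finite_toSet
  calc ((restrictedCluster a C).ncard : ℝ≥0∞) ^ 2 ≤ (F.card : ℝ≥0∞) ^ 2 := by gcongr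
    _ = ∑ x ∈ F, ∑ y ∈ F, 1 := by simp [sq]
    _ ≤ ∑ x ∈ F, ∑ y ∈ box (1 / a) with IsClose a ε x y, if x ∈ C ∧ y ∈ C then 1 else 0 := by
        refine Finset.sum_le_sum fun x hx => ?_
        have hsub : F ⊆ (box (1 / a)).filter fun y => IsClose a ε x y := fun y hy =>
          Finset.mem_filter.2 ⟨(Finset.mem_filter.1 hy).1, hclose x hx y hy⟩
        refine le_trans (Finset.sum_le_sum fun y hy => ?_)
          (Finset.sum_le_sum_of_subset (f := fun y => if x ∈ C ∧ y ∈ C then (1 : ℝ≥0∞) else 0) hsub)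
        rw [if_pos ⟨(Finset.mem_filter.1 hx).2, (Finset.mem_filter.1 hy).2⟩]
    _ ≤ _ := Finset.sum_le_sum_of_subset (Finset.filter_subset _ _)

open Classical in
theorem smallClusterSum_le {a ε : ℝ} (ha : 0 < a) (n : BondConfig) :
    smallClusterSum a ε n ≤ ∑ x ∈ box (1 / a), ∑ y ∈ box (1 / a) with IsClose a ε x y,
      if (openGraph n).Reachable x y then 1 else 0 := by
  have h1 : smallClusterSum a ε n ≤ ∑' C : (openGraph n).ConnectedComponent,
      ∑ x ∈ box (1 / a), ∑ y ∈ box (1 / a) with IsClose a ε x y,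
        if x ∈ C.supp ∧ y ∈ C.supp then (1 : ℝ≥0∞) else 0 := by
    refine ENNReal.tsum_le_tsum fun C => ?_
    split_ifs with h
    · exact sq_ncard_restrictedCluster_le ha _ h
    · exact zero_le
  refine h1.trans ?_
  rw [Summable.tsum_finsetSum fun _ _ => ENNReal.summable]
  refine Finset.sum_le_sum fun x _ => ?_
  rw [Summable.tsum_finsetSum fun _ _ => ENNReal.summable]
  refine Finset.sum_le_sum fun y _ => ?_
  -- Only the component of `x` contributes to the pair `(x, y)`.
  rw [tsum_eq_single ((openGraph n).connectedComponentMk x)]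
  · simp only [SimpleGraph.ConnectedComponent.mem_supp_iff, SimpleGraph.ConnectedComponent.eq,
      SimpleGraph.reachable_comm, true_and]
    exact le_rfl
  · intro C hC
    rw [if_neg]
    rintro ⟨hx, -⟩
    exact hC hx.symm

theorem lintegral_sum_connEvent_le {β : ℝ} {P : Measure (SpinConfig × BondConfig)}
    (hP : IsInfiniteSystem β P) (hβ : 0 ≤ β) (p : Site → Site → Prop) [DecidableRel p]
    (A : Finset Site) :
    ∫⁻ c, ∑ x ∈ A, ∑ y ∈ A with p x y, (connEvent x y).indicator 1 c ∂P ≤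
      ENNReal.ofReal (∑ x ∈ A, ∑ y ∈ A with p x y, twoPoint P (y - x)) := by
  have hτ := hP.twoPoint_nonneg hβ
  have hmeas : ∀ x y, Measurable ((connEvent x y).indicator (1 : SpinConfig × BondConfig → ℝ≥0∞)) := fun x y =>
    measurable_one.indicator (measurableSet_connEvent x y)
  rw [lintegral_finsetSum _ fun x _ => Finset.measurable_fun_sum _ fun y _ => hmeas x y,
    ENNReal.ofReal_sum_of_nonneg fun x _ => Finset.sum_nonneg fun y _ => hτ _]
  refine Finset.sum_le_sum fun x _ => ?_
  rw [lintegral_finsetSum _ fun y _ => hmeas x y, ENNReal.ofReal_sum_of_nonneg fun y _ => hτ _]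
  refine Finset.sum_le_sum fun y _ => ?_
  rw [lintegral_indicator_one (measurableSet_connEvent x y)]
  exact hP.measure_connEvent_le hβ x y

open Classical in
theorem lintegral_smallClusterSum_le {β : ℝ} {P : Measure (SpinConfig × BondConfig)}
    (hP : IsInfiniteSystem β P) (hβ : 0 ≤ β) {a ε : ℝ} (ha : 0 < a) :
    ∫⁻ c, smallClusterSum a ε c.2 ∂P ≤ ENNReal.ofReal
      (∑ x ∈ box (1 / a), ∑ y ∈ box (1 / a) with IsClose a ε x y, twoPoint P (y - x)) := by
  refine le_trans (lintegral_mono fun c => ?_)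
    (lintegral_sum_connEvent_le hP hβ (IsClose a ε) (box (1 / a)))
  refine (smallClusterSum_le ha c.2).trans_eq ?_
  refine Finset.sum_congr rfl fun x _ => Finset.sum_congr rfl fun y _ => ?_
  rw [Set.indicator_apply]
  rfl

/-! ### The scale factor and the final estimate -/

theorem scaleFactor_sq {τ : Site → ℝ} (hτ : ∀ z, 0 ≤ τ z) (a : ℝ) :
    scaleFactor τ a ^ 2 = (∑ x ∈ box (1 / a), ∑ y ∈ box (1 / a), τ (y - x))⁻¹ := by
  rw [scaleFactor, inv_pow, Real.sq_sqrt]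
  exact Finset.sum_nonneg fun x _ => Finset.sum_nonneg fun y _ => hτ _

theorem box_eq {L : ℝ} (hL : 0 ≤ L) :
    box L = Finset.Icc (0 : ℤ) ⌊L⌋₊ ×ˢ Finset.Icc (0 : ℤ) ⌊L⌋₊ := by
  rw [box, Int.natCast_floor_eq_floor hL]

theorem sum_box_pos {τ : Site → ℝ} (hτ : ∀ z, 0 ≤ τ z) (h0 : 0 < τ 0) {a : ℝ} (ha : 0 < a) :
    0 < ∑ x ∈ box (1 / a), ∑ y ∈ box (1 / a), τ (y - x) := by
  have hm : (0 : Site) ∈ box (1 / a) := by rw [box_eq (by positivity)]; simp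
  refine Finset.sum_pos' (fun x _ => Finset.sum_nonneg fun y _ => hτ _) ⟨0, hm, ?_⟩
  exact Finset.sum_pos' (fun y _ => hτ _) ⟨0, hm, by simpa using h0⟩

theorem rescaledSmallArea_le {β : ℝ} {P : Measure (SpinConfig × BondConfig)}
    (hP : IsInfiniteSystem β P) (hβ : 0 ≤ β) {a ε c : ℝ} (ha : 0 < a)
    (h : ∀ p : Site → Site → Prop, ∀ _ : DecidableRel p,
      (∀ x y, p x y → y - x ∈ square ⌊ε / a⌋₊) →
      ∑ x ∈ box (1 / a), ∑ y ∈ box (1 / a) with p x y, twoPoint P (y - x) ≤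
        c * ∑ x ∈ box (1 / a), ∑ y ∈ box (1 / a), twoPoint P (y - x)) :
    rescaledSmallArea P a ε ≤ ENNReal.ofReal c := by
  classical
  have := hP.1
  have hτ := hP.twoPoint_nonneg hβ
  have hN := sum_box_pos hτ (twoPoint_zero (P := P) ▸ one_pos) ha
  rw [rescaledSmallArea, scaleFactor_sq hτ]
  refine (mul_le_mul_right (lintegral_smallClusterSum_le hP hβ ha) _).trans ?_
  rw [← ENNReal.ofReal_mul (by positivity)]
  refine ENNReal.ofReal_le_ofReal ?_
  rw [inv_mul_le_iff₀ hN, mul_comm]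
  exact h _ _ fun x y => sub_mem_square_of_isClose ha

theorem rescaledSmallArea_le_one {β : ℝ} {P : Measure (SpinConfig × BondConfig)}
    (hP : IsInfiniteSystem β P) (hβ : 0 ≤ β) {a ε : ℝ} (ha : 0 < a) :
    rescaledSmallArea P a ε ≤ 1 := by
  rw [← ENNReal.ofReal_one]
  refine rescaledSmallArea_le hP hβ ha fun p _ _ => ?_
  rw [one_mul]
  exact Finset.sum_le_sum fun x _ => Finset.sum_le_sum_of_subset_of_nonneg
    (Finset.filter_subset _ _) fun y _ _ => hP.twoPoint_nonneg hβ _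

theorem exists_limsup_le {β : ℝ} {P : Measure (SpinConfig × BondConfig)}
    (hP : IsInfiniteSystem β P) (hβ : 0 < β) {θ : ℝ} (hθ : θ < 1)
    (hyp : PowerLawComparison (twoPoint P) θ) :
    ∃ K : ℝ, ∀ ε : ℝ, 0 < ε →
      limsup (fun a : ℝ => rescaledSmallArea P a ε) (𝓝[>] 0) ≤
        ENNReal.ofReal (K * ε ^ (2 * (1 - θ))) := by
  have hτ := hP.twoPoint_nonneg hβ.le
  obtain ⟨K, hK, h⟩ := exists_eventually_squareSum_le hτ (hP.twoPoint_pos hβ) hθ hyp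
  obtain ⟨Q, hQ⟩ := eventually_atTop.1 h
  set e := 2 * (1 - θ) with he
  have he0 : 0 < e := by linarith
  -- Below `ε₀` the choice of `q` further down satisfies `q ≥ Q`, so the growth estimate applies;
  -- above it the trivial bound 1 is at most `(ε / ε₀) ^ e`.
  set ε₀ : ℝ := 1 / (16 * (Q + 1)) with hε₀
  have hε₀0 : 0 < ε₀ := by positivity
  have hε₀1 : ε₀ ≤ 1 / 8 := by
    refine one_div_le_one_div_of_le (by norm_num) ?_
    linarith [(Nat.cast_nonneg Q : (0 : ℝ) ≤ Q)]
  refine ⟨max (4 / K * 16 ^ e) ((ε₀ ^ e)⁻¹), fun ε hε => ?_⟩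
  have hεe : 0 ≤ ε ^ e := by positivity
  rcases le_total ε₀ ε with hle | hle
  · refine limsup_le_of_le (h := ?_)
    filter_upwards [self_mem_nhdsWithin] with a ha
    refine (rescaledSmallArea_le_one hP hβ.le ha).trans ?_
    rw [← ENNReal.ofReal_one]
    refine ENNReal.ofReal_le_ofReal ?_
    refine le_trans ?_ (mul_le_mul_of_nonneg_right (le_max_right _ _) hεe)
    rw [inv_mul_eq_div, one_le_div (by positivity)]
    exact Real.rpow_le_rpow hε₀0.le hle he0.le
  -- The enlargement factor `2q + 1` is of order `1 / ε`: at most `1 / (4ε)`, so that the enlarged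
  -- square fits in half the box, and at least `1 / (16ε)`.
  · set q := ⌊1 / (16 * ε)⌋₊ with hq
    have hqQ : Q ≤ q := by
      refine Nat.le_floor ?_
      rw [hε₀, le_div_iff₀ (by positivity)] at hle
      rw [le_div_iff₀ (by positivity)]
      nlinarith
    have hq1 : (q : ℝ) ≤ 1 / (16 * ε) := Nat.floor_le (by positivity)
    have hq2 : 1 / (16 * ε) < q + 1 := Nat.lt_floor_add_one _
    have hp : (0 : ℝ) < 2 * q + 1 := by positivity
    have hpε : (2 * q + 1) * ε ≤ 1 / 4 := by
      rw [le_div_iff₀ (by positivity)] at hq1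
      linarith
    have hpe : 0 < K * (2 * q + 1 : ℝ) ^ e := by positivity
    refine limsup_le_of_le (h := ?_)
    have hk : Tendsto (fun a : ℝ => ⌊ε / a⌋₊) (𝓝[>] 0) atTop :=
      tendsto_nat_floor_atTop.comp (tendsto_inv_nhdsGT_zero.const_mul_atTop hε)
    filter_upwards [self_mem_nhdsWithin, hk.eventually (hQ q hqQ),
      tendsto_inv_nhdsGT_zero.eventually_ge_atTop (4 * q + 2 : ℝ)] with a ha hS hL
    have ha : 0 < a := ha
    have hbound : rescaledSmallArea P a ε ≤ ENNReal.ofReal (4 / (K * (2 * q + 1 : ℝ) ^ e)) := by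
      refine rescaledSmallArea_le hP hβ.le ha fun p _ hpc => ?_
      have h1 := sum_box_le hτ (box (1 / a)) ⌊ε / a⌋₊ p hpc
      -- The main term takes at most half of `1 / a`; the leftover `2q` fits in the other half once
      -- `1 / a ≥ 4q + 2`.
      have hm : 2 * ((2 * q + 1) * ⌊ε / a⌋₊ + q) ≤ ⌊1 / a⌋₊ := by
        refine Nat.le_floor ?_
        push_cast
        have h3 : (⌊ε / a⌋₊ : ℝ) ≤ ε * a⁻¹ := Nat.floor_le (by positivity)
        have h4 : (2 * q + 1 : ℝ) * ⌊ε / a⌋₊ ≤ 1 / 4 * a⁻¹ := by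
          calc (2 * q + 1 : ℝ) * ⌊ε / a⌋₊ ≤ (2 * q + 1) * (ε * a⁻¹) := by gcongr
            _ = (2 * q + 1) * ε * a⁻¹ := by ring
            _ ≤ _ := by gcongr
        rw [one_div]
        linarith
      have h2 := le_sum_box hτ _ _ hm
      rw [← box_eq (by positivity)] at h2
      rw [div_mul_eq_mul_div, le_div_iff₀ hpe]
      refine le_trans ?_ h2
      refine (mul_le_mul_of_nonneg_right h1 hpe.le).trans ?_
      rw [mul_assoc, mul_comm (squareSum _ _)]
      exact mul_le_mul_of_nonneg_left hS (Nat.cast_nonneg _)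
    refine hbound.trans (ENNReal.ofReal_le_ofReal ?_)
    refine le_trans ?_ (mul_le_mul_of_nonneg_right (le_max_left _ _) hεe)
    rw [mul_assoc, ← Real.mul_rpow (by norm_num) hε.le, div_le_iff₀ hpe]
    have h5 : 1 ≤ (16 * ε) ^ e * (2 * q + 1 : ℝ) ^ e := by
      rw [← Real.mul_rpow (by positivity) hp.le]
      refine Real.one_le_rpow ?_ he0.le
      rw [div_lt_iff₀ (by positivity)] at hq2
      nlinarith [(Nat.cast_nonneg q : (0 : ℝ) ≤ q)]
    calc (4 : ℝ) ≤ 4 * ((16 * ε) ^ e * (2 * q + 1 : ℝ) ^ e) := by linarith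
      _ = _ := by field_simp

end IsingFK

end

theorem proposition1 (βc : ℝ) (hβc : IsingFK.IsCriticalInverseTemperature βc)
    (P : Measure (IsingFK.SpinConfig × IsingFK.BondConfig))
    (hP : IsingFK.IsInfiniteSystem βc P)
    (θ : ℝ) (hθ : θ < 1)
    (hyp : IsingFK.PowerLawComparison (IsingFK.twoPoint P) θ) :
    Tendsto (fun ε : ℝ => limsup (fun a : ℝ => IsingFK.rescaledSmallArea P a ε) (𝓝[>] 0))
        (𝓝[>] 0) (𝓝 0) ∧
      ∃ K : ℝ, ∀ ε : ℝ, 0 < ε →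
        limsup (fun a : ℝ => IsingFK.rescaledSmallArea P a ε) (𝓝[>] 0) ≤
          ENNReal.ofReal (K * ε ^ (2 * (1 - θ))) := by
  obtain ⟨K, hK⟩ := IsingFK.exists_limsup_le hP hβc.pos hθ hyp
  refine ⟨?_, K, hK⟩
  have hlim : Tendsto (fun ε : ℝ => ENNReal.ofReal (K * ε ^ (2 * (1 - θ)))) (𝓝[>] 0) (𝓝 0) := by
    have he : 0 < 2 * (1 - θ) := by linarith
    have h1 : Tendsto (fun ε : ℝ => K * ε ^ (2 * (1 - θ))) (𝓝 0) (𝓝 (K * 0 ^ (2 * (1 - θ)))) :=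
      ((Real.continuousAt_rpow_const 0 _ (.inr he.le)).tendsto).const_mul K
    rw [Real.zero_rpow he.ne', mul_zero] at h1
    simpa using ENNReal.tendsto_ofReal (h1.mono_left nhdsWithin_le_nhds)
  refine tendsto_of_tendsto_of_tendsto_of_le_of_le' tendsto_const_nhds hlim
    (Eventually.of_forall fun _ => zero_le) ?_
  filter_upwards [self_mem_nhdsWithin] with ε hε using hK ε hε
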